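/- Let $L\ge 2$, let $n_0,\dots,n_L$ be natural numbers, and let $d,d'$ be natural numbers. Let $$\mathcal U=\prod_{i=1}^{L}(\mathbb R^{d})^{n_i\times n_{i-1}}\times\prod_{i=1}^{L}(\mathbb R^{d})^{n_i\times 1}$$ be the weight space of elements $U=([W],[b])$, $[W]^{(i)}\in(\mathbb R^d)^{n_i\times n_{i-1}}$, $[b]^{(i)}\in(\mathbb R^d)^{n_i\times 1}$, and let $\mathcal U'$ be defined in the same way with $d'$ in place of $d$. Matrices with entries in $\mathbb R^d$ are multiplied separately in each of the $d$ coordinates. Let $$G=\{I_{n_L}\}\times\mathcal M^{>0}_{n_{L-1}}\times\dots\times\mathcal M^{>0}_{n_1}\times\{I_{n_0}\},$$ where $\mathcal M^{>0}_m$ is the group of $m\times m$ matrices $D P$ with $D$ diagonal with positive diagonal entries and $P$ a permutation matrix. The element $g=(g^{(L)},\dots,g^{(0)})\in G$ acts on $\mathcal U$ (and likewise on $\mathcal U'$) by $[gW]^{(i)}=g^{(i)}[W]^{(i)}(g^{(i-1)})^{-1}$ and $[gb]^{(i)}=g^{(i)}[b]^{(i)}$. Fix matrices $\Psi^{(s)(L,t)}\in(\mathbb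 R^d)^{1\times n_L}$ and $\Psi^{(s,0)(L,t)}\in(\mathbb R^d)^{n_0\times n_L}$, and put $$[W]^{(s,t)}=[W]^{(s)}[W]^{(s-1)}\cdots[W]^{(t+1)},\qquad [Wb]^{(s,t)(t)}=[W]^{(s,t)}[b]^{(t)},$$ $$[bW]^{(s)(L,t)}=[b]^{(s)}\Psi^{(s)(L,t)}[W]^{(L,t)},\qquad [WW]^{(s,0)(L,t)}=[W]^{(s,0)}\Psi^{(s,0)(L,t)}[W]^{(L,t)}.$$ Let $E:\mathcal U\to\mathcal U'$, $E(U)=([E(W)],[E(b)])$, be a map such that each entry $[E(W)]^{(i)}_{jk}$ and $[E(b)]^{(i)}_j$ of the output is of the form $$\sum_{L\ge s>t\ge 0}\sum_{p,q}\Phi_{(s,t):pq}[W]^{(s,t)}_{pq}+\sum_{L\ge s>0}\sum_p\Phi_{(s):p}[b]^{(s)}_p+\sum_{L\ge s>t>0}\sum_p\Phi_{(s,t)(t):p}[Wb]^{(s,t)(t)}_p$$ $$+\sum_{L\ge s>0}\sum_{L>t\ge0}\sum_{p,q}\Phi_{(s)(L,t):pq}[bW]^{(s)(L,t)}_{pq}+\sum_{L\ge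 s>0}\sum_{L>t\ge0}\sum_{p,q}\Phi_{(s,0)(L,t):pq}[WW]^{(s,0)(L,t)}_{pq}+\Phi_1$$ with coefficients $\Phi\in\mathbb R^{d'\times d}$ and bias $\Phi_1\in\mathbb R^{d'}$ that depend on the output entry (on $i,j,k$, respectively on $i,j$). Then $E$ is $G$-equivariant, i.e. $E(gU)=gE(U)$ for all $g\in G$ and $U\in\mathcal U$, if and only if there are coefficients in $\mathbb R^{d'\times d}$ and biases $\Phi_1^{(L):j}\in\mathbb R^{d'}$, independent of $U$, such that the following holds for all $U$ and all $j,k$. A bullet $\bullet$ means that the coefficient does not depend on the index at that place. * For $i=L$: $$[E(W)]^{(L)}_{jk}=\sum_{p=1}^{n_L}\Phi^{(L):j\bullet}_{(L,L-1):p\bullet}[W]^{(L,L-1)}_{pk}+\sum_{p=1}^{n_L}\Phi^{(L):j\bullet}_{(L,0)(L,L-1):p\bullet}[WW]^{(L,0)(L,L-1)}_{pk}+\sum_{p=1}^{n_L}\Phi^{(L):j\bullet}_{(L)(L,L-1):p\bullet}[bW]^{(L)(L,L-1)}_{pk},$$ $$[E(b)]^{(L)}_{j}=\sum_{p=1}^{n_L}\sum_{q=1}^{n_0}\Phi^{(L):j}_{(L,0)(L,0):pq}[WW]^{(L,0)(L,0)}_{pq}+\sum_{p=1}^{n_L}\sum_{q=1}^{n_0}\Phi^{(L):j}_{(L,0):pq}[W]^{(L,0)}_{pq}+\sum_{L>s>0}\sum_{p=1}^{n_s}\Phi^{(L):j}_{(s,0)(L,s):\bullet\bullet}[WW]^{(s,0)(L,s)}_{pp}$$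 $$+\sum_{p=1}^{n_L}\sum_{q=1}^{n_0}\Phi^{(L):j}_{(L)(L,0):pq}[bW]^{(L)(L,0)}_{pq}+\sum_{L>t>0}\sum_{p=1}^{n_L}\Phi^{(L):j}_{(L,t)(t):p}[Wb]^{(L,t)(t)}_{p}+\sum_{L>t>0}\sum_{p=1}^{n_t}\Phi^{(L):j}_{(t)(L,t):\bullet\bullet}[bW]^{(t)(L,t)}_{pp}+\sum_{p=1}^{n_L}\Phi^{(L):j}_{(L):p}[b]^{(L)}_p+\Phi_1^{(L):j}.$$ * For $i=1$: $$[E(W)]^{(1)}_{jk}=\sum_{q=1}^{n_0}\Phi^{(1):\bullet k}_{(1,0):\bullet q}[W]^{(1,0)}_{jq}+\sum_{q=1}^{n_0}\Phi^{(1):\bullet k}_{(1,0)(L,0):\bullet q}[WW]^{(1,0)(L,0)}_{jq}+\sum_{q=1}^{n_0}\Phi^{(1):\bullet k}_{(1)(L,0):\bullet q}[bW]^{(1)(L,0)}_{jq}+\Phi^{(1):\bullet k}_{(1):\bullet}[b]^{(1)}_j,$$ $$[E(b)]^{(1)}_{j}=\sum_{q=1}^{n_0}\Phi^{(1):\bullet}_{(1,0):\bullet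 q}[W]^{(1,0)}_{jq}+\sum_{q=1}^{n_0}\Phi^{(1):\bullet}_{(1,0)(L,0):\bullet q}[WW]^{(1,0)(L,0)}_{jq}+\sum_{q=1}^{n_0}\Phi^{(1):\bullet}_{(1)(L,0):\bullet q}[bW]^{(1)(L,0)}_{jq}+\Phi^{(1):\bullet}_{(1):\bullet}[b]^{(1)}_j.$$ * For $1<i<L$: $$[E(W)]^{(i)}_{jk}=\Phi^{(i):\bullet\bullet}_{(i,i-1):\bullet\bullet}[W]^{(i,i-1)}_{jk}+\Phi^{(i):\bullet\bullet}_{(i,0)(L,i-1):\bullet\bullet}[WW]^{(i,0)(L,i-1)}_{jk}+\Phi^{(i):\bullet\bullet}_{(i)(L,i-1):\bullet\bullet}[bW]^{(i)(L,i-1)}_{jk},$$ $$[E(b)]^{(i)}_{j}=\sum_{q=1}^{n_0}\Phi^{(i):\bullet}_{(i,0):\bullet q}[W]^{(i,0)}_{jq}+\sum_{q=1}^{n_0}\Phi^{(i):\bullet}_{(i,0)(L,0):\bullet q}[WW]^{(i,0)(L,0)}_{jq}+\sum_{i>t>0}\Phi^{(i):\bullet}_{(i,t)(t):\bullet}[Wb]^{(i,t)(t)}_{j}+\sum_{q=1}^{n_0}\Phi^{(i):\bullet}_{(i)(L,0):\bullet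 q}[bW]^{(i)(L,0)}_{jq}+\Phi^{(i):\bullet}_{(i):\bullet}[b]^{(i)}_j.$$ -/

import Mathlib

namespace PolyNFN

/-- The weight space of a network with `L` layers, `n i` channels at layer `i` (`0 ≤ i ≤ L`) and
`d`-dimensional weights and biases: `W^(i) ∈ (ℝ^d)^(n_i × n_(i-1))` and `b^(i) ∈ (ℝ^d)^(n_i × 1)`
for `1 ≤ i ≤ L`. An index `i : Fin L` stands for the layer `i.succ ∈ {1, …, L}`, the layer before
it being `i.castSucc`. Entries lie in the ring `Fin d → ℝ`, so that products of matrices are taken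
separately in each of the `d` coordinates. -/
@[ext]
structure WeightSpace (L : ℕ) (n : Fin (L + 1) → ℕ) (d : ℕ) where
  W : (i : Fin L) → Matrix (Fin (n i.succ)) (Fin (n i.castSucc)) (Fin d → ℝ)
  b : (i : Fin L) → Matrix (Fin (n i.succ)) (Fin 1) (Fin d → ℝ)

/-- A real matrix as a matrix over `Fin d → ℝ`, acting in the same way in every coordinate. -/
def lift {m m' : ℕ} (d : ℕ) (A : Matrix (Fin m) (Fin m') ℝ) :
    Matrix (Fin m) (Fin m') (Fin d → ℝ) :=
  A.map (algebraMap ℝ (Fin d → ℝ))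

theorem lift_one (m d : ℕ) : lift d (1 : Matrix (Fin m) (Fin m) ℝ) = 1 :=
  Matrix.map_one _ (map_zero _) (map_one _)

theorem lift_mul {m m' m'' : ℕ} (d : ℕ) (A : Matrix (Fin m) (Fin m') ℝ)
    (B : Matrix (Fin m') (Fin m'') ℝ) : lift d (A * B) = lift d A * lift d B :=
  Matrix.map_mul

/-- The action `[gW]^(i) = g^(i) [W]^(i) (g^(i-1))⁻¹`, `[gb]^(i) = g^(i) [b]^(i)`. -/
noncomputable instance (L : ℕ) (n : Fin (L + 1) → ℕ) (d : ℕ) :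
    MulAction ((i : Fin (L + 1)) → GL (Fin (n i)) ℝ) (WeightSpace L n d) where
  smul g U :=
    { W := fun i => lift d (g i.succ).val * U.W i * lift d ((g i.castSucc)⁻¹).val
      b := fun i => lift d (g i.succ).val * U.b i }
  one_smul U := by
    apply WeightSpace.ext
    · funext i
      change lift d ((1 : GL (Fin (n i.succ)) ℝ)).val * U.W i *
        lift d ((1 : GL (Fin (n i.castSucc)) ℝ)⁻¹).val = U.W i
      rw [inv_one, Units.val_one, Units.val_one, lift_one, lift_one, Matrix.one_mul,
        Matrix.mul_one]
    · funext i
      change lift d ((1 : GL (Fin (n i.succ)) ℝ)).val * U.b i = U.b i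
      rw [Units.val_one, lift_one, Matrix.one_mul]
  mul_smul g h U := by
    apply WeightSpace.ext
    · funext i
      change lift d (g i.succ * h i.succ).val * U.W i *
          lift d ((g i.castSucc * h i.castSucc)⁻¹).val =
        lift d (g i.succ).val * (lift d (h i.succ).val * U.W i *
          lift d ((h i.castSucc)⁻¹).val) * lift d ((g i.castSucc)⁻¹).val
      rw [mul_inv_rev, Units.val_mul, Units.val_mul, lift_mul, lift_mul]
      simp only [Matrix.mul_assoc]
    · funext i
      change lift d (g i.succ * h i.succ).val * U.b i =
        lift d (g i.succ).val * (lift d (h i.succ).val * U.b i)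
      rw [Units.val_mul, lift_mul, Matrix.mul_assoc]

theorem diagonal_mul_perm_apply {m : ℕ} (c : Fin m → ℝ) (π : Equiv.Perm (Fin m)) (p q : Fin m) :
    (Matrix.diagonal c * π.permMatrix ℝ) p q = if π p = q then c p else 0 := by
  simp [Matrix.diagonal_mul, Equiv.Perm.permMatrix, PEquiv.toMatrix_apply, Equiv.toPEquiv_apply,
    eq_comm]

theorem diagonal_mul_perm_mul {m : ℕ} (c c' : Fin m → ℝ) (π π' : Equiv.Perm (Fin m)) :
    (Matrix.diagonal c * π.permMatrix ℝ) * (Matrix.diagonal c' * π'.permMatrix ℝ) =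
      Matrix.diagonal (fun p => c p * c' (π p)) * (π' * π).permMatrix ℝ := by
  ext p q
  rw [Matrix.mul_apply, diagonal_mul_perm_apply]
  simp only [diagonal_mul_perm_apply, ite_mul, zero_mul]
  rw [Finset.sum_ite_eq]
  simp only [Finset.mem_univ, if_true, mul_ite, mul_zero, Equiv.Perm.mul_apply]
  congr

/-- The group `𝓜^{>0}_m` of monomial matrices with positive nonzero entries: the products of a
diagonal matrix with positive diagonal and a permutation matrix. -/
def posMonomial (m : ℕ) : Subgroup (GL (Fin m) ℝ) where
  carrier := {g | ∃ (c : Fin m → ℝ) (π : Equiv.Perm (Fin m)),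
    (∀ p, 0 < c p) ∧ g.val = Matrix.diagonal c * π.permMatrix ℝ}
  one_mem' := ⟨fun _ => 1, 1, fun _ => one_pos, by simp⟩
  mul_mem' := by
    rintro g h ⟨c, π, hc, hg⟩ ⟨c', π', hc', hh⟩
    exact ⟨fun p => c p * c' (π p), π' * π, fun p => mul_pos (hc p) (hc' _), by
      rw [Units.val_mul, hg, hh, diagonal_mul_perm_mul]⟩
  inv_mem' := by
    rintro g ⟨c, π, hc, hg⟩
    refine ⟨fun p => (c (π⁻¹ p))⁻¹, π⁻¹, fun p => inv_pos.2 (hc _), ?_⟩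
    apply Units.inv_eq_of_mul_eq_one_right
    rw [hg, diagonal_mul_perm_mul]
    have : (fun p => c p * (c (π⁻¹ (π p)))⁻¹) = fun _ => 1 := by
      funext p
      simp [(hc p).ne']
    rw [this]
    simp

/-- The symmetry group `G = {I} × 𝓜^{>0}_{n_(L-1)} × ⋯ × 𝓜^{>0}_{n_1} × {I}`: trivial at the layers
`0` and `L`. -/
def symmetryGroup (L : ℕ) (n : Fin (L + 1) → ℕ) :
    Subgroup ((i : Fin (L + 1)) → GL (Fin (n i)) ℝ) :=
  Subgroup.pi Set.univ fun i => if i = 0 ∨ i = Fin.last L then ⊥ else posMonomial (n i)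

/-- `E(gU) = g E(U)` for all `g ∈ G` and all `U`. -/
def IsEquivariant {L : ℕ} {n : Fin (L + 1) → ℕ} {d d' : ℕ}
    (E : WeightSpace L n d → WeightSpace L n d') : Prop :=
  ∀ g ∈ symmetryGroup L n, ∀ U : WeightSpace L n d, E (g • U) = g • E U

/-- The connection matrices `Ψ^(s)(L,t)` (of size `1 × n_L`, with `s` the layer `s.succ`) and
`Ψ^(s,0)(L,t)` (of size `n_0 × n_L`). -/
structure Connection (L : ℕ) (n : Fin (L + 1) → ℕ) (d : ℕ) where
  bW : (s : Fin L) → (t : Fin (L + 1)) → Matrix (Fin 1) (Fin (n (Fin.last L))) (Fin d → ℝ)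
  WW : (s t : Fin (L + 1)) → Matrix (Fin (n 0)) (Fin (n (Fin.last L))) (Fin d → ℝ)

namespace WeightSpace

variable {L : ℕ} {n : Fin (L + 1) → ℕ} {d : ℕ}

/-- `[W]^(s,t) = [W]^(s) [W]^(s-1) ⋯ [W]^(t+1)` for `s > t`. By convention it is the identity matrix
for `s = t`, and `0` for `s < t`. -/
def prodW (U : WeightSpace L n d) (s t : Fin (L + 1)) :
    Matrix (Fin (n s)) (Fin (n t)) (Fin d → ℝ) :=
  if h : (t : ℕ) ≤ s then
    Nat.leRec
      (motive := fun m _ => (hm : m < L + 1) →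
        Matrix (Fin (n ⟨m, hm⟩)) (Fin (n t)) (Fin d → ℝ))
      (fun _ => 1)
      (fun m _ P hm =>
        let i : Fin L := ⟨m, Nat.lt_of_succ_lt_succ hm⟩
        let Q : Matrix (Fin (n i.castSucc)) (Fin (n t)) (Fin d → ℝ) := P (Nat.lt_of_succ_lt hm)
        U.W i * Q)
      h s.isLt
  else 0

theorem prodW_self (U : WeightSpace L n d) (t : Fin (L + 1)) : U.prodW t t = 1 := by
  unfold prodW
  rw [dif_pos le_rfl, Nat.leRec_self]

theorem prodW_succ (U : WeightSpace L n d) (i : Fin L) (t : Fin (L + 1)) (h : t ≤ i.castSucc) :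
    U.prodW i.succ t = U.W i * U.prodW i.castSucc t := by
  have h1 : (t : ℕ) ≤ i := h
  have h2 : (t : ℕ) ≤ (i : ℕ) + 1 := Nat.le_succ_of_le h1
  have e1 : ((i.succ : Fin (L + 1)) : ℕ) = (i : ℕ) + 1 := rfl
  unfold prodW
  rw [dif_pos (show (t : ℕ) ≤ (i.succ : Fin (L + 1)) from h2),
    dif_pos (show (t : ℕ) ≤ (i.castSucc : Fin (L + 1)) from h1)]
  exact congrFun (Nat.leRec_succ
    (motive := fun m _ => (hm : m < L + 1) →
      Matrix (Fin (n ⟨m, hm⟩)) (Fin (n t)) (Fin d → ℝ)) _ _ h1 (h2 := h2)) _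

/-- `[Wb]^(s,t)(t) = [W]^(s,t) [b]^(t)`, where the second argument `t` stands for layer `t.succ`. -/
def prodWb (U : WeightSpace L n d) (s : Fin (L + 1)) (t : Fin L) :
    Matrix (Fin (n s)) (Fin 1) (Fin d → ℝ) :=
  U.prodW s t.succ * U.b t

/-- `[bW]^(s)(L,t) = [b]^(s) Ψ^(s)(L,t) [W]^(L,t)`, where the first argument `s` stands for layer
`s.succ`. -/
def prodbW (Ψ : Connection L n d) (U : WeightSpace L n d) (s : Fin L) (t : Fin (L + 1)) :
    Matrix (Fin (n s.succ)) (Fin (n t)) (Fin d → ℝ) :=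
  U.b s * Ψ.bW s t * U.prodW (Fin.last L) t

/-- `[WW]^(s,0)(L,t) = [W]^(s,0) Ψ^(s,0)(L,t) [W]^(L,t)`. -/
def prodWW (Ψ : Connection L n d) (U : WeightSpace L n d) (s t : Fin (L + 1)) :
    Matrix (Fin (n s)) (Fin (n t)) (Fin d → ℝ) :=
  U.prodW s 0 * Ψ.WW s t * U.prodW (Fin.last L) t

end WeightSpace

/-- The coefficients `Φ` of a linear combination of stable polynomial terms with values in `ℝ^d'`,
together with the bias `Φ_1`. In `b`, in the first argument of `bW` and in the second argument of
`Wb`, an index `i : Fin L` stands for layer `i.succ`. -/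
structure Coeffs (L : ℕ) (n : Fin (L + 1) → ℕ) (d d' : ℕ) where
  W : (s t : Fin (L + 1)) → Fin (n s) → Fin (n t) → Matrix (Fin d') (Fin d) ℝ
  b : (s : Fin L) → Fin (n s.succ) → Matrix (Fin d') (Fin d) ℝ
  Wb : (s : Fin (L + 1)) → (t : Fin L) → Fin (n s) → Matrix (Fin d') (Fin d) ℝ
  bW : (s : Fin L) → (t : Fin (L + 1)) → Fin (n s.succ) → Fin (n t) → Matrix (Fin d') (Fin d) ℝ
  WW : (s t : Fin (L + 1)) → Fin (n s) → Fin (n t) → Matrix (Fin d') (Fin d) ℝ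
  bias : Fin d' → ℝ

open scoped Matrix

/-- The linear combination of all stable polynomial terms of `U` with coefficients `Φ`, plus the
bias. The sums run over `L ≥ s > t ≥ 0` for `[W]^(s,t)`, over `L ≥ s > 0` for `[b]^(s)`, over
`L ≥ s > t > 0` for `[Wb]^(s,t)(t)`, and over `L ≥ s > 0`, `L > t ≥ 0` for `[bW]^(s)(L,t)` and
`[WW]^(s,0)(L,t)`. -/
def stableComb {L : ℕ} {n : Fin (L + 1) → ℕ} {d d' : ℕ} (Ψ : Connection L n d)
    (Φ : Coeffs L n d d') (U : WeightSpace L n d) : Fin d' → ℝ :=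
  (∑ s : Fin (L + 1), ∑ t : Fin (L + 1) with t < s, ∑ p, ∑ q, Φ.W s t p q *ᵥ U.prodW s t p q)
  + (∑ s : Fin L, ∑ p, Φ.b s p *ᵥ U.b s p 0)
  + (∑ s : Fin (L + 1), ∑ t : Fin L with t.succ < s, ∑ p, Φ.Wb s t p *ᵥ U.prodWb s t p 0)
  + (∑ s : Fin L, ∑ t : Fin L, ∑ p, ∑ q,
      Φ.bW s t.castSucc p q *ᵥ U.prodbW Ψ s t.castSucc p q)
  + (∑ s : Fin L, ∑ t : Fin L, ∑ p, ∑ q,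
      Φ.WW s.succ t.castSucc p q *ᵥ U.prodWW Ψ s.succ t.castSucc p q)
  + Φ.bias

/-- Every entry of the output of `E` is a linear combination of stable polynomial terms, formed with
the connection matrices `Ψ`, plus a bias. -/
def IsPolynomialLayer {L : ℕ} {n : Fin (L + 1) → ℕ} {d d' : ℕ} (Ψ : Connection L n d)
    (E : WeightSpace L n d → WeightSpace L n d') : Prop :=
  (∀ (i : Fin L) (j : Fin (n i.succ)) (k : Fin (n i.castSucc)),
    ∃ Φ : Coeffs L n d d', ∀ U, (E U).W i j k = stableComb Ψ Φ U) ∧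
  (∀ (i : Fin L) (j : Fin (n i.succ)),
    ∃ Φ : Coeffs L n d d', ∀ U, (E U).b i j 0 = stableComb Ψ Φ U)

section Forms

variable {L : ℕ} {n : Fin (L + 1) → ℕ} {d d' : ℕ} (Ψ : Connection L n d)
  (E : WeightSpace L n d → WeightSpace L n d') (i : Fin L)

/-- The form of `[E(W)]^(L)`; to be used for `i.succ = L`. -/
def WeightFormLast : Prop :=
  ∃ φW φWW φbW : Fin (n i.succ) → Fin (n i.succ) → Matrix (Fin d') (Fin d) ℝ,
    ∀ U j k, (E U).W i j k =
      (∑ p, φW j p *ᵥ U.prodW i.succ i.castSucc p k)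
      + (∑ p, φWW j p *ᵥ U.prodWW Ψ i.succ i.castSucc p k)
      + ∑ p, φbW j p *ᵥ U.prodbW Ψ i i.castSucc p k

/-- The form of `[E(b)]^(L)`; to be used for `i.succ = L`. The coefficients `ψWW j s` and `ψbW j t`
do not depend on the diagonal position `p`. -/
def BiasFormLast : Prop :=
  ∃ (φWW φW φbW : Fin (n i.succ) → Fin (n i.succ) → Fin (n 0) → Matrix (Fin d') (Fin d) ℝ)
    (ψWW ψbW : Fin (n i.succ) → Fin L → Matrix (Fin d') (Fin d) ℝ)
    (φWb : Fin (n i.succ) → Fin L → Fin (n i.succ) → Matrix (Fin d') (Fin d) ℝ)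
    (φb : Fin (n i.succ) → Fin (n i.succ) → Matrix (Fin d') (Fin d) ℝ)
    (φ1 : Fin (n i.succ) → Fin d' → ℝ),
    ∀ U j, (E U).b i j 0 =
      (∑ p, ∑ q, φWW j p q *ᵥ U.prodWW Ψ i.succ 0 p q)
      + (∑ p, ∑ q, φW j p q *ᵥ U.prodW i.succ 0 p q)
      + (∑ s : Fin L with s.succ < Fin.last L, ∑ p, ψWW j s *ᵥ U.prodWW Ψ s.succ s.succ p p)
      + (∑ p, ∑ q, φbW j p q *ᵥ U.prodbW Ψ i 0 p q)
      + (∑ t : Fin L with t.succ < Fin.last L, ∑ p, φWb j t p *ᵥ U.prodWb i.succ t p 0)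
      + (∑ t : Fin L with t.succ < Fin.last L, ∑ p, ψbW j t *ᵥ U.prodbW Ψ t t.succ p p)
      + (∑ p, φb j p *ᵥ U.b i p 0)
      + φ1 j

/-- The form of `[E(W)]^(1)`; to be used for `i.succ = 1`. -/
def WeightFormFirst : Prop :=
  ∃ (φW φWW φbW : Fin (n i.castSucc) → Fin (n 0) → Matrix (Fin d') (Fin d) ℝ)
    (φb : Fin (n i.castSucc) → Matrix (Fin d') (Fin d) ℝ),
    ∀ U j k, (E U).W i j k =
      (∑ q, φW k q *ᵥ U.prodW i.succ 0 j q)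
      + (∑ q, φWW k q *ᵥ U.prodWW Ψ i.succ 0 j q)
      + (∑ q, φbW k q *ᵥ U.prodbW Ψ i 0 j q)
      + φb k *ᵥ U.b i j 0

/-- The form of `[E(b)]^(1)`; to be used for `i.succ = 1`. -/
def BiasFormFirst : Prop :=
  ∃ (φW φWW φbW : Fin (n 0) → Matrix (Fin d') (Fin d) ℝ) (φb : Matrix (Fin d') (Fin d) ℝ),
    ∀ U j, (E U).b i j 0 =
      (∑ q, φW q *ᵥ U.prodW i.succ 0 j q)
      + (∑ q, φWW q *ᵥ U.prodWW Ψ i.succ 0 j q)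
      + (∑ q, φbW q *ᵥ U.prodbW Ψ i 0 j q)
      + φb *ᵥ U.b i j 0

/-- The form of `[E(W)]^(i.succ)`; to be used for `1 < i.succ < L`. -/
def WeightFormMiddle : Prop :=
  ∃ φW φWW φbW : Matrix (Fin d') (Fin d) ℝ,
    ∀ U j k, (E U).W i j k =
      φW *ᵥ U.prodW i.succ i.castSucc j k
      + φWW *ᵥ U.prodWW Ψ i.succ i.castSucc j k
      + φbW *ᵥ U.prodbW Ψ i i.castSucc j k

/-- The form of `[E(b)]^(i.succ)`; to be used for `1 < i.succ < L`. -/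
def BiasFormMiddle : Prop :=
  ∃ (φW φWW φbW : Fin (n 0) → Matrix (Fin d') (Fin d) ℝ)
    (φWb : Fin L → Matrix (Fin d') (Fin d) ℝ) (φb : Matrix (Fin d') (Fin d) ℝ),
    ∀ U j, (E U).b i j 0 =
      (∑ q, φW q *ᵥ U.prodW i.succ 0 j q)
      + (∑ q, φWW q *ᵥ U.prodWW Ψ i.succ 0 j q)
      + (∑ t : Fin L with t.succ < i.succ, φWb t *ᵥ U.prodWb i.succ t j 0)
      + (∑ q, φbW q *ᵥ U.prodbW Ψ i 0 j q)
      + φb *ᵥ U.b i j 0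

end Forms

end PolyNFN

namespace PolyNFN

open scoped Matrix

/-! Each stable term transforms under `g` like one entry of a weight or bias. In a product
`[W]^(s,t)` the inner factors of `g` cancel, and the connection matrices meet only `g^(L) = I` and
`g^(0) = I`. An entry `(p, q)` between layers `s` and `t` is therefore multiplied by `c_s(p) /
c_t(q)` and moved to `(π_s p, π_t q)`. With these rules the listed forms are equivariant by
inspection. Only the traces over a hidden layer need a remark: their factors cancel and the
permutation reindexes the sum.

Conversely, take positive scalings `exp x_v`, one for each hidden channel `v`. Every term is then
multiplied by a character `x ↦ exp (u ⬝ x)`, with `u` the difference of two basis vectors, where end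
layers contribute `0`. Equivariance gives the output entry a prescribed weight `u₀`. Distinct
characters are linearly independent, so the terms of weight other than `u₀` can be dropped
(`exists_weight_projection`, `eq_weight_part`). The equation `u = u₀` is solved in the
`channelWeight` lemmas and leaves exactly the terms in the statement.

It remains to remove the dependence of the coefficients on hidden indices. The stable terms may be
linearly dependent as functions of `U`, so coefficients are never compared. Instead, one
representation is chosen at a base position and transported by transpositions
(`exists_transposition`). For the traces in the last bias, the representation is averaged over all
permutations (`average_perm_mulVec`). -/

/-- The family `g` consists of the monomial matrices with coefficients `c` and permutations `π`,
trivial at the layers `0` and `L`. -/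
structure IsMonomial {L : ℕ} {n : Fin (L + 1) → ℕ} (g : (l : Fin (L + 1)) → GL (Fin (n l)) ℝ)
    (c : (l : Fin (L + 1)) → Fin (n l) → ℝ) (π : (l : Fin (L + 1)) → Equiv.Perm (Fin (n l))) :
    Prop where
  pos : ∀ l p, 0 < c l p
  val_eq : ∀ l, (g l).val = Matrix.diagonal (c l) * (π l).permMatrix ℝ
  coeff_end : ∀ l, l = 0 ∨ l = Fin.last L → c l = 1
  perm_end : ∀ l, l = 0 ∨ l = Fin.last L → π l = 1

/-! ### The action of monomial matrices on the stable terms -/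

section Action

variable {L : ℕ} {n : Fin (L + 1) → ℕ} {d d' : ℕ}

theorem exists_isMonomial {g : (l : Fin (L + 1)) → GL (Fin (n l)) ℝ}
    (hg : g ∈ symmetryGroup L n) : ∃ c π, IsMonomial g c π := by
  have key : ∀ l, ∃ (c : Fin (n l) → ℝ) (π : Equiv.Perm (Fin (n l))), (∀ p, 0 < c p) ∧
      (g l).val = Matrix.diagonal c * π.permMatrix ℝ ∧
      (l = 0 ∨ l = Fin.last L → c = 1) ∧ (l = 0 ∨ l = Fin.last L → π = 1) := by
    intro l
    have hl := hg l (Set.mem_univ l)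
    by_cases h : l = 0 ∨ l = Fin.last L
    · simp only [h, if_true] at hl
      refine ⟨1, 1, fun _ => one_pos, ?_, fun _ => rfl, fun _ => rfl⟩
      have : g l = 1 := hl
      rw [this]
      simp
    · simp only [h, if_false] at hl
      obtain ⟨c, π, hc, hv⟩ := hl
      exact ⟨c, π, hc, hv, fun h' => absurd h' h, fun h' => absurd h' h⟩
  choose c π h1 h2 h3 h4 using key
  exact ⟨c, π, h1, h2, h3, h4⟩

theorem exists_mem_symmetryGroup (c : (l : Fin (L + 1)) → Fin (n l) → ℝ)
    (π : (l : Fin (L + 1)) → Equiv.Perm (Fin (n l))) (hc : ∀ l p, 0 < c l p)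
    (hc1 : ∀ l, l = 0 ∨ l = Fin.last L → c l = 1) (hπ1 : ∀ l, l = 0 ∨ l = Fin.last L → π l = 1) :
    ∃ g ∈ symmetryGroup L n, IsMonomial g c π := by
  let g : (l : Fin (L + 1)) → GL (Fin (n l)) ℝ := fun l =>
    { val := Matrix.diagonal (c l) * (π l).permMatrix ℝ
      inv := Matrix.diagonal (fun p => (c l ((π l)⁻¹ p))⁻¹) * ((π l)⁻¹).permMatrix ℝ
      val_inv := by
        rw [diagonal_mul_perm_mul]
        have : (fun p => c l p * (c l ((π l)⁻¹ (π l p)))⁻¹) = fun _ => 1 := by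
          funext p
          simp [(hc l p).ne']
        rw [this]
        simp
      inv_val := by
        rw [diagonal_mul_perm_mul]
        have : (fun p => (c l ((π l)⁻¹ p))⁻¹ * c l ((π l)⁻¹ p)) = fun _ => 1 := by
          funext p
          simp [(hc l _).ne']
        rw [this]
        simp }
  refine ⟨g, ?_, hc, fun _ => rfl, hc1, hπ1⟩
  intro l _
  by_cases h : l = 0 ∨ l = Fin.last L
  · simp only [h, if_true]
    change g l = 1
    apply Units.ext
    change Matrix.diagonal (c l) * (π l).permMatrix ℝ = 1
    rw [hc1 l h, hπ1 l h]
    simp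
  · simp only [h, if_false]
    exact ⟨c l, π l, hc l, rfl⟩

theorem lift_monomial_mul_apply {m m' : ℕ} (c : Fin m → ℝ) (π : Equiv.Perm (Fin m))
    (X : Matrix (Fin m) (Fin m') (Fin d → ℝ)) (p : Fin m) (q : Fin m') :
    (lift d (Matrix.diagonal c * π.permMatrix ℝ) * X) p q = c p • X (π p) q := by
  rw [Matrix.mul_apply, Finset.sum_eq_single (π p)]
  · rw [lift, Matrix.map_apply, diagonal_mul_perm_apply, if_pos rfl, Algebra.smul_def]
  · intro r _ hr
    rw [lift, Matrix.map_apply, diagonal_mul_perm_apply, if_neg hr.symm, map_zero, zero_mul]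
  · simp

theorem mul_lift_inv_monomial_apply {m m' : ℕ} {g : GL (Fin m') ℝ} {c : Fin m' → ℝ}
    {π : Equiv.Perm (Fin m')} (hc : ∀ p, 0 < c p)
    (hg : g.val = Matrix.diagonal c * π.permMatrix ℝ)
    (X : Matrix (Fin m) (Fin m') (Fin d → ℝ)) (p : Fin m) (q : Fin m') :
    (X * lift d (g⁻¹).val) p q = (c q)⁻¹ • X p (π q) := by
  have hinv : (g⁻¹).val =
      Matrix.diagonal (fun p => (c (π⁻¹ p))⁻¹) * (π⁻¹).permMatrix ℝ := by
    apply Units.inv_eq_of_mul_eq_one_right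
    rw [hg, diagonal_mul_perm_mul]
    have : (fun p => c p * (c (π⁻¹ (π p)))⁻¹) = fun _ => 1 := by
      funext p
      simp [(hc p).ne']
    rw [this]
    simp
  rw [hinv, Matrix.mul_apply, Finset.sum_eq_single (π q)]
  · rw [lift, Matrix.map_apply, diagonal_mul_perm_apply, if_pos (by simp), Algebra.smul_def,
      mul_comm]
    simp
  · intro r _ hr
    rw [lift, Matrix.map_apply, diagonal_mul_perm_apply, if_neg, map_zero, mul_zero]
    rintro rfl
    simp at hr
  · simp

theorem smul_W (g : (l : Fin (L + 1)) → GL (Fin (n l)) ℝ) (U : WeightSpace L n d) (i : Fin L) :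
    (g • U).W i = lift d (g i.succ).val * U.W i * lift d ((g i.castSucc)⁻¹).val := rfl

theorem smul_b (g : (l : Fin (L + 1)) → GL (Fin (n l)) ℝ) (U : WeightSpace L n d) (i : Fin L) :
    (g • U).b i = lift d (g i.succ).val * U.b i := rfl

theorem lift_inv_mul_lift {m : ℕ} (g : GL (Fin m) ℝ) : lift d (g⁻¹).val * lift d g.val = 1 := by
  rw [← lift_mul, Units.inv_mul, lift_one]

theorem lift_mul_lift_inv {m : ℕ} (g : GL (Fin m) ℝ) : lift d g.val * lift d (g⁻¹).val = 1 := by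
  rw [← lift_mul, Units.mul_inv, lift_one]

theorem prodW_of_lt (U : WeightSpace L n d) {s t : Fin (L + 1)} (h : s < t) : U.prodW s t = 0 := by
  unfold WeightSpace.prodW
  rw [dif_neg]
  exact not_le.2 h

/-- The product telescopes: each `(g^(l))⁻¹` meets `g^(l)` at an inner layer. The conventions `1`
for `s = t` and `0` for `s < t` are compatible with this, so no order on `s` and `t` is needed. -/
theorem prodW_smul (g : (l : Fin (L + 1)) → GL (Fin (n l)) ℝ) (U : WeightSpace L n d)
    (s t : Fin (L + 1)) :
    (g • U).prodW s t = lift d (g s).val * U.prodW s t * lift d ((g t)⁻¹).val := by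
  induction s using Fin.induction with
  | zero =>
    rcases eq_or_ne t 0 with rfl | ht
    · rw [WeightSpace.prodW_self, WeightSpace.prodW_self, Matrix.mul_one, lift_mul_lift_inv]
    · have ht := Fin.pos_iff_ne_zero.2 ht
      rw [prodW_of_lt _ ht, prodW_of_lt _ ht, Matrix.mul_zero, Matrix.zero_mul]
  | succ i ih =>
    rcases lt_trichotomy t i.succ with h | rfl | h
    · have h' : t ≤ i.castSucc := Fin.le_castSucc_iff.2 h
      rw [WeightSpace.prodW_succ _ _ _ h', WeightSpace.prodW_succ _ _ _ h', ih, smul_W]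
      calc _ = lift d (g i.succ).val * U.W i * (lift d ((g i.castSucc)⁻¹).val *
            lift d (g i.castSucc).val) * U.prodW i.castSucc t * lift d ((g t)⁻¹).val := by
            simp only [Matrix.mul_assoc]
        _ = _ := by
            rw [lift_inv_mul_lift, Matrix.mul_one]
            simp only [Matrix.mul_assoc]
    · rw [WeightSpace.prodW_self, WeightSpace.prodW_self, Matrix.mul_one, lift_mul_lift_inv]
    · rw [prodW_of_lt _ h, prodW_of_lt _ h, Matrix.mul_zero, Matrix.zero_mul]

namespace IsMonomial

variable {g : (l : Fin (L + 1)) → GL (Fin (n l)) ℝ} {c : (l : Fin (L + 1)) → Fin (n l) → ℝ}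
  {π : (l : Fin (L + 1)) → Equiv.Perm (Fin (n l))} (h : IsMonomial g c π)

include h

theorem eq_one {l : Fin (L + 1)} (hl : l = 0 ∨ l = Fin.last L) : g l = 1 := by
  apply Units.ext
  rw [h.val_eq, h.coeff_end l hl, h.perm_end l hl]
  simp

theorem conj_apply (s t : Fin (L + 1)) (X : Matrix (Fin (n s)) (Fin (n t)) (Fin d → ℝ))
    (p : Fin (n s)) (q : Fin (n t)) :
    (lift d (g s).val * X * lift d ((g t)⁻¹).val) p q =
      (c s p * (c t q)⁻¹) • X (π s p) (π t q) := by
  rw [mul_lift_inv_monomial_apply (h.pos t) (h.val_eq t), h.val_eq s, lift_monomial_mul_apply,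
    smul_smul, mul_comm]

theorem smul_W_apply (U : WeightSpace L n d) (i : Fin L) (j : Fin (n i.succ))
    (k : Fin (n i.castSucc)) :
    (g • U).W i j k = (c i.succ j * (c i.castSucc k)⁻¹) • U.W i (π _ j) (π _ k) := by
  rw [smul_W, h.conj_apply]

theorem smul_b_apply (U : WeightSpace L n d) (i : Fin L) (j : Fin (n i.succ)) (k : Fin 1) :
    (g • U).b i j k = c i.succ j • U.b i (π _ j) k := by
  rw [smul_b, h.val_eq, lift_monomial_mul_apply]

theorem prodW_apply (U : WeightSpace L n d) (s t : Fin (L + 1)) (p : Fin (n s)) (q : Fin (n t)) :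
    (g • U).prodW s t p q = (c s p * (c t q)⁻¹) • U.prodW s t (π s p) (π t q) := by
  rw [prodW_smul, h.conj_apply]

theorem prodWb_apply (U : WeightSpace L n d) (s : Fin (L + 1)) (t : Fin L) (p : Fin (n s))
    (k : Fin 1) :
    (g • U).prodWb s t p k = c s p • U.prodWb s t (π s p) k := by
  have : (g • U).prodWb s t = lift d (g s).val * U.prodWb s t := by
    unfold WeightSpace.prodWb
    rw [prodW_smul, smul_b, Matrix.mul_assoc _ _ (_ * _), ← Matrix.mul_assoc _ _ (U.b t),
      lift_inv_mul_lift, Matrix.one_mul, Matrix.mul_assoc]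
  rw [this, h.val_eq, lift_monomial_mul_apply]

/-- The right factor contributes `g^(L)` next to the connection matrix, and this is the identity;
hence `Ψ` may be arbitrary. -/
theorem prodbW_apply (Ψ : Connection L n d) (U : WeightSpace L n d) (s : Fin L) (t : Fin (L + 1))
    (p : Fin (n s.succ)) (q : Fin (n t)) :
    (g • U).prodbW Ψ s t p q =
      (c s.succ p * (c t q)⁻¹) • U.prodbW Ψ s t (π _ p) (π _ q) := by
  rw [← h.conj_apply]
  unfold WeightSpace.prodbW
  rw [prodW_smul, smul_b, h.eq_one (Or.inr rfl), Units.val_one, lift_one]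
  simp only [Matrix.mul_assoc, Matrix.one_mul]

theorem prodWW_apply (Ψ : Connection L n d) (U : WeightSpace L n d) (s t : Fin (L + 1))
    (p : Fin (n s)) (q : Fin (n t)) :
    (g • U).prodWW Ψ s t p q =
      (c s p * (c t q)⁻¹) • U.prodWW Ψ s t (π _ p) (π _ q) := by
  rw [← h.conj_apply]
  unfold WeightSpace.prodWW
  rw [prodW_smul, prodW_smul, h.eq_one (Or.inr rfl), h.eq_one (Or.inl rfl), inv_one, Units.val_one,
    Units.val_one, lift_one, lift_one]
  simp only [Matrix.mul_assoc, Matrix.one_mul]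

end IsMonomial

end Action

/-- Equivariance, with the entries of both sides written out. -/
theorem isEquivariant_iff {L : ℕ} {n : Fin (L + 1) → ℕ} {d d' : ℕ}
    (E : WeightSpace L n d → WeightSpace L n d') :
    IsEquivariant E ↔ ∀ g c π, g ∈ symmetryGroup L n → IsMonomial g c π → ∀ U i j,
      (∀ k, (E (g • U)).W i j k =
        (c i.succ j * (c i.castSucc k)⁻¹) • (E U).W i (π _ j) (π _ k)) ∧
      (E (g • U)).b i j 0 = c i.succ j • (E U).b i (π _ j) 0 := by
  constructor
  · intro hE g c π hg h U i j
    rw [hE g hg U]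
    exact ⟨fun k => h.smul_W_apply _ _ _ _, h.smul_b_apply _ _ _ _⟩
  · intro H g hg U
    obtain ⟨c, π, h⟩ := exists_isMonomial hg
    apply WeightSpace.ext
    · funext i j k
      rw [(H g c π hg h U i j).1 k, h.smul_W_apply]
    · funext i j k
      obtain rfl := Subsingleton.elim 0 k
      rw [(H g c π hg h U i j).2, h.smul_b_apply]

/-! ### The listed forms are equivariant -/

section FormsEquivariant

variable {L : ℕ} {n : Fin (L + 1) → ℕ} {d d' : ℕ} {Ψ : Connection L n d}
  {E : WeightSpace L n d → WeightSpace L n d'} {i : Fin L}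
  {g : (l : Fin (L + 1)) → GL (Fin (n l)) ℝ} {c : (l : Fin (L + 1)) → Fin (n l) → ℝ}
  {π : (l : Fin (L + 1)) → Equiv.Perm (Fin (n l))} (h : IsMonomial g c π)

include h

theorem IsMonomial.coeff_zero (q : Fin (n 0)) : c 0 q = 1 := by
  rw [h.coeff_end 0 (Or.inl rfl), Pi.one_apply]

theorem IsMonomial.perm_zero : π 0 = 1 := h.perm_end 0 (Or.inl rfl)

theorem WeightFormLast.smul (hE : WeightFormLast Ψ E i) (hi : i.succ = Fin.last L)
    (U : WeightSpace L n d) (j : Fin (n i.succ)) (k : Fin (n i.castSucc)) :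
    (E (g • U)).W i j k =
      (c i.succ j * (c i.castSucc k)⁻¹) • (E U).W i (π _ j) (π _ k) := by
  obtain ⟨φW, φWW, φbW, hE⟩ := hE
  have hc := h.coeff_end i.succ (Or.inr hi)
  have hπ := h.perm_end i.succ (Or.inr hi)
  simp only [hE, h.prodW_apply, h.prodWW_apply, h.prodbW_apply, hc, hπ, Pi.one_apply, one_mul,
    Equiv.Perm.one_apply, Matrix.mulVec_smul, smul_add, Finset.smul_sum]

theorem WeightFormFirst.smul (hE : WeightFormFirst Ψ E i) (hi : i.castSucc = 0)
    (U : WeightSpace L n d) (j : Fin (n i.succ)) (k : Fin (n i.castSucc)) :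
    (E (g • U)).W i j k =
      (c i.succ j * (c i.castSucc k)⁻¹) • (E U).W i (π _ j) (π _ k) := by
  obtain ⟨φW, φWW, φbW, φb, hE⟩ := hE
  have hc := h.coeff_end i.castSucc (Or.inl hi)
  have hπ := h.perm_end i.castSucc (Or.inl hi)
  simp only [hE, h.prodW_apply, h.prodWW_apply, h.prodbW_apply, h.smul_b_apply, hc, hπ,
    h.coeff_zero, h.perm_zero, Pi.one_apply, inv_one, mul_one,
    Equiv.Perm.one_apply, Matrix.mulVec_smul, smul_add, Finset.smul_sum]

theorem WeightFormMiddle.smul (hE : WeightFormMiddle Ψ E i)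
    (U : WeightSpace L n d) (j : Fin (n i.succ)) (k : Fin (n i.castSucc)) :
    (E (g • U)).W i j k =
      (c i.succ j * (c i.castSucc k)⁻¹) • (E U).W i (π _ j) (π _ k) := by
  obtain ⟨φW, φWW, φbW, hE⟩ := hE
  simp only [hE, h.prodW_apply, h.prodWW_apply, h.prodbW_apply, Matrix.mulVec_smul, smul_add]

theorem BiasFormFirst.smul (hE : BiasFormFirst Ψ E i) (U : WeightSpace L n d)
    (j : Fin (n i.succ)) :
    (E (g • U)).b i j 0 = c i.succ j • (E U).b i (π _ j) 0 := by
  obtain ⟨φW, φWW, φbW, φb, hE⟩ := hE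
  simp only [hE, h.prodW_apply, h.prodWW_apply, h.prodbW_apply, h.smul_b_apply,
    h.coeff_zero, h.perm_zero, inv_one, mul_one,
    Equiv.Perm.one_apply, Matrix.mulVec_smul, smul_add, Finset.smul_sum]

theorem BiasFormMiddle.smul (hE : BiasFormMiddle Ψ E i) (U : WeightSpace L n d)
    (j : Fin (n i.succ)) :
    (E (g • U)).b i j 0 = c i.succ j • (E U).b i (π _ j) 0 := by
  obtain ⟨φW, φWW, φbW, φWb, φb, hE⟩ := hE
  simp only [hE, h.prodW_apply, h.prodWW_apply, h.prodbW_apply, h.prodWb_apply, h.smul_b_apply,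
    h.coeff_zero, h.perm_zero, inv_one, mul_one,
    Equiv.Perm.one_apply, Matrix.mulVec_smul, smul_add, Finset.smul_sum]

/-- On the diagonal the row and column scalings are inverse to each other, and the permutation only
reorders the summands. -/
theorem IsMonomial.sum_trace (s : Fin (L + 1)) (A : Matrix (Fin d') (Fin d) ℝ)
    (X : Matrix (Fin (n s)) (Fin (n s)) (Fin d → ℝ)) :
    ∑ p, A *ᵥ ((c s p * (c s p)⁻¹) • X (π s p) (π s p)) = ∑ p, A *ᵥ X p p := by
  rw [← Equiv.sum_comp (π s) fun p => A *ᵥ X p p]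
  refine Finset.sum_congr rfl fun p _ => ?_
  rw [mul_inv_cancel₀ (h.pos s p).ne', one_smul]

theorem BiasFormLast.smul (hE : BiasFormLast Ψ E i) (hi : i.succ = Fin.last L)
    (U : WeightSpace L n d) (j : Fin (n i.succ)) :
    (E (g • U)).b i j 0 = c i.succ j • (E U).b i (π _ j) 0 := by
  obtain ⟨φWW, φW, φbW, ψWW, ψbW, φWb, φb, φ1, hE⟩ := hE
  have hc := h.coeff_end i.succ (Or.inr hi)
  have hπ := h.perm_end i.succ (Or.inr hi)
  -- The traces are the only terms that involve hidden channels here. They are invariant as sums and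
  -- not term by term, so they are settled before the entrywise rules are applied.
  have h1 : ∀ s : Fin L, ∑ p, ψWW j s *ᵥ (g • U).prodWW Ψ s.succ s.succ p p =
      ∑ p, ψWW j s *ᵥ U.prodWW Ψ s.succ s.succ p p := fun s => by
    simp only [h.prodWW_apply, h.sum_trace]
  have h2 : ∀ s : Fin L, ∑ p, ψbW j s *ᵥ (g • U).prodbW Ψ s s.succ p p =
      ∑ p, ψbW j s *ᵥ U.prodbW Ψ s s.succ p p := fun s => by
    simp only [h.prodbW_apply, h.sum_trace]
  simp only [hE, h1, h2]
  simp only [h.prodW_apply, h.prodWW_apply, h.prodbW_apply, h.prodWb_apply, h.smul_b_apply,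
    h.coeff_zero, h.perm_zero, hc, hπ, Pi.one_apply, inv_one, mul_one,
    Equiv.Perm.one_apply, one_smul]

end FormsEquivariant

/-! ### Independence of exponential characters -/

/-- The character `x ↦ exp (u ⬝ x)` of the additive group `V → ℝ`. -/
noncomputable def expChar {V : Type*} [Fintype V] (u : V → ℝ) : Multiplicative (V → ℝ) →* ℝ where
  toFun x := Real.exp (u ⬝ᵥ x.toAdd)
  map_one' := by simp
  map_mul' x y := by rw [toAdd_mul, dotProduct_add, Real.exp_add]

theorem expChar_injective {V : Type*} [Fintype V] :
    Function.Injective (expChar : (V → ℝ) → Multiplicative (V → ℝ) →* ℝ) := by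
  classical
  intro u v h
  funext a
  have := DFunLike.congr_fun h (Multiplicative.ofAdd (Pi.single a 1))
  simpa [expChar] using this

/-- There is a linear projection onto the component of a given exponential weight. -/
theorem exists_weight_projection {V : Type*} [Fintype V] (κ : Type*) (u₀ : V → ℝ) :
    ∃ Λ : ((V → ℝ) → κ → ℝ) →ₗ[ℝ] (κ → ℝ), ∀ u v,
      (u = u₀ → Λ (fun x => Real.exp (u ⬝ᵥ x) • v) = v) ∧
      (u ≠ u₀ → Λ (fun x => Real.exp (u ⬝ᵥ x) • v) = 0) := by
  -- Dedekind: distinct characters are linearly independent.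
  have hli : LinearIndependent ℝ
      (fun u : V → ℝ => (expChar u : Multiplicative (V → ℝ) → ℝ)) :=
    (linearIndependent_monoidHom (Multiplicative (V → ℝ)) ℝ).comp expChar expChar_injective
  -- The coefficient of the character `u₀` is a functional on the span of the characters; any linear
  -- extension to all functions will do.
  obtain ⟨l, hl⟩ := LinearMap.exists_extend
    ((Finsupp.lapply u₀ : ((V → ℝ) →₀ ℝ) →ₗ[ℝ] ℝ) ∘ₗ hli.repr)
  have hl' : ∀ u, l (expChar u : Multiplicative (V → ℝ) → ℝ) = (Finsupp.single u 1 : _ →₀ ℝ) u₀ := by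
    intro u
    have hu : (expChar u : Multiplicative (V → ℝ) → ℝ) ∈ Submodule.span ℝ (Set.range
        fun u : V → ℝ => (expChar u : Multiplicative (V → ℝ) → ℝ)) :=
      Submodule.subset_span ⟨u, rfl⟩
    have := LinearMap.congr_fun hl ⟨_, hu⟩
    rw [LinearMap.comp_apply, Submodule.subtype_apply] at this
    rw [this, LinearMap.comp_apply, Finsupp.lapply_apply]
    congr 1
    exact hli.repr_eq_single u ⟨_, hu⟩ rfl
  -- `l` is applied in each coordinate of `κ` separately.
  let Λ : ((V → ℝ) → κ → ℝ) →ₗ[ℝ] (κ → ℝ) :=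
    LinearMap.pi fun k => l ∘ₗ
      (LinearMap.pi fun x => (LinearMap.proj k : (κ → ℝ) →ₗ[ℝ] ℝ) ∘ₗ
        (LinearMap.proj x.toAdd : ((V → ℝ) → κ → ℝ) →ₗ[ℝ] (κ → ℝ)))
  have hΛ : ∀ u v k, Λ (fun x => Real.exp (u ⬝ᵥ x) • v) k =
      v k * (Finsupp.single u 1 : _ →₀ ℝ) u₀ := by
    intro u v k
    rw [← hl' u, ← smul_eq_mul, ← map_smul]
    change l _ = l _
    congr 1
    funext x
    exact mul_comm _ _
  refine ⟨Λ, fun u v => ⟨?_, ?_⟩⟩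
  · rintro rfl
    funext k
    rw [hΛ, Finsupp.single_eq_same, mul_one]
  · intro h
    funext k
    rw [hΛ, Finsupp.single_eq_of_ne h.symm, mul_zero, Pi.zero_apply]

/-! ### Weights under the scaling action -/

section Weights

variable {L : ℕ} {n : Fin (L + 1) → ℕ} {d d' : ℕ}

open Classical in
/-- The weight of the channel `p` of layer `l` under the scaling action: a standard basis vector
for a hidden layer, `0` for the layers `0` and `L`. -/
noncomputable def channelWeight (l : Fin (L + 1)) (p : Fin (n l)) : (Σ l, Fin (n l)) → ℝ :=
  if l = 0 ∨ l = Fin.last L then 0 else Pi.single ⟨l, p⟩ 1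

/-- The vector `x` holds the logarithms of the scaling factors. Its components at the layers `0` and
`L` play no role, since the weights there vanish. -/
theorem exists_scaling (x : (Σ l, Fin (n l)) → ℝ) : ∃ g ∈ symmetryGroup L n,
    IsMonomial g (fun l p => Real.exp (channelWeight l p ⬝ᵥ x)) 1 := by
  refine exists_mem_symmetryGroup _ _ (fun _ _ => Real.exp_pos _) ?_ (fun _ _ => rfl)
  intro l hl
  funext p
  simp [channelWeight, hl]

open Classical in
/-- If a combination of stable terms is homogeneous of weight `u₀` under the scaling action, then
the terms of the other weights can be left out. -/
theorem eq_weight_part {Ψ : Connection L n d} {Φ : Coeffs L n d d'}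
    {f : WeightSpace L n d → Fin d' → ℝ} {u₀ : (Σ l, Fin (n l)) → ℝ}
    (hf : ∀ U, f U = stableComb Ψ Φ U)
    (hu : ∀ x, ∀ g ∈ symmetryGroup L n,
      IsMonomial g (fun l p => Real.exp (channelWeight l p ⬝ᵥ x)) 1 →
      ∀ U, f (g • U) = Real.exp (u₀ ⬝ᵥ x) • f U) (U : WeightSpace L n d) :
    f U = (∑ s : Fin (L + 1), ∑ t : Fin (L + 1) with t < s, ∑ p, ∑ q,
        if channelWeight s p - channelWeight t q = u₀ then Φ.W s t p q *ᵥ U.prodW s t p q else 0)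
      + (∑ s : Fin L, ∑ p, if channelWeight s.succ p = u₀ then Φ.b s p *ᵥ U.b s p 0 else 0)
      + (∑ s : Fin (L + 1), ∑ t : Fin L with t.succ < s, ∑ p,
        if channelWeight s p = u₀ then Φ.Wb s t p *ᵥ U.prodWb s t p 0 else 0)
      + (∑ s : Fin L, ∑ t : Fin (L + 1) with t < Fin.last L, ∑ p, ∑ q,
        if channelWeight s.succ p - channelWeight t q = u₀ then
          Φ.bW s t p q *ᵥ U.prodbW Ψ s t p q else 0)
      + (∑ s : Fin L, ∑ t : Fin (L + 1) with t < Fin.last L, ∑ p, ∑ q,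
        if channelWeight s.succ p - channelWeight t q = u₀ then
          Φ.WW s.succ t p q *ᵥ U.prodWW Ψ s.succ t p q else 0)
      + if 0 = u₀ then Φ.bias else 0 := by
  -- Letting `t` range over all layers below `L` makes the sums over `t : Fin L` comparable with a
  -- fixed layer in `Fin (L + 1)`.
  have hcast : ∀ F : Fin (L + 1) → Fin d' → ℝ,
      ∑ t : Fin (L + 1) with t < Fin.last L, F t = ∑ t : Fin L, F t.castSucc := by
    intro F
    rw [Finset.sum_filter, Fin.sum_univ_castSucc]
    simp [Fin.castSucc_lt_last]
  simp only [hcast]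
  obtain ⟨Λ, hΛ⟩ := exists_weight_projection (Fin d') u₀
  have hΛ' : ∀ u v, Λ (fun x => Real.exp (u ⬝ᵥ x) • v) = if u = u₀ then v else 0 := by
    intro u v
    split_ifs with h
    exacts [(hΛ u v).1 h, (hΛ u v).2 h]
  -- For fixed `U`, both expressions for `f (g • U)` are functions of the scaling parameter `x`; the
  -- projection `Λ` is then applied to both.
  have key : (fun x => Real.exp (u₀ ⬝ᵥ x) • f U) =
      (∑ s : Fin (L + 1), ∑ t : Fin (L + 1) with t < s, ∑ p, ∑ q, fun x =>
        Real.exp ((channelWeight s p - channelWeight t q) ⬝ᵥ x) •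
          Φ.W s t p q *ᵥ U.prodW s t p q)
      + (∑ s : Fin L, ∑ p, fun x => Real.exp (channelWeight s.succ p ⬝ᵥ x) •
          Φ.b s p *ᵥ U.b s p 0)
      + (∑ s : Fin (L + 1), ∑ t : Fin L with t.succ < s, ∑ p, fun x =>
        Real.exp (channelWeight s p ⬝ᵥ x) • Φ.Wb s t p *ᵥ U.prodWb s t p 0)
      + (∑ s : Fin L, ∑ t : Fin L, ∑ p, ∑ q, fun x =>
        Real.exp ((channelWeight s.succ p - channelWeight t.castSucc q) ⬝ᵥ x) •
          Φ.bW s t.castSucc p q *ᵥ U.prodbW Ψ s t.castSucc p q)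
      + (∑ s : Fin L, ∑ t : Fin L, ∑ p, ∑ q, fun x =>
        Real.exp ((channelWeight s.succ p - channelWeight t.castSucc q) ⬝ᵥ x) •
          Φ.WW s.succ t.castSucc p q *ᵥ U.prodWW Ψ s.succ t.castSucc p q)
      + fun x => Real.exp (0 ⬝ᵥ x) • Φ.bias := by
    funext x
    obtain ⟨g, hg, h⟩ := exists_scaling x
    rw [← hu x g hg h U, hf]
    simp only [stableComb, h.prodW_apply, h.prodbW_apply, h.prodWW_apply, h.prodWb_apply,
      h.smul_b_apply, Pi.one_apply, Equiv.Perm.one_apply, Matrix.mulVec_smul,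
      sub_eq_add_neg, neg_dotProduct, add_dotProduct, Real.exp_add, Real.exp_neg,
      zero_dotProduct, Real.exp_zero, one_smul, Pi.add_apply, Finset.sum_apply]
  have := congrArg Λ key
  simp only [map_add, map_sum, hΛ'] at this
  simpa using this

end Weights

/-! ### Which pairs of channels have a given weight -/

section ChannelWeight

variable {L : ℕ} {n : Fin (L + 1) → ℕ}

open Classical in
theorem channelWeight_apply (l : Fin (L + 1)) (p : Fin (n l)) (v : Σ l, Fin (n l)) :
    channelWeight l p v = if (l = 0 ∨ l = Fin.last L) ∨ v ≠ ⟨l, p⟩ then 0 else 1 := by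
  unfold channelWeight
  by_cases h : l = 0 ∨ l = Fin.last L
  · simp [h]
  · by_cases hv : v = ⟨l, p⟩
    · subst hv
      simp [h]
    · simp [h, hv]

theorem channelWeight_of_end {l : Fin (L + 1)} (h : l = 0 ∨ l = Fin.last L) (p : Fin (n l)) :
    channelWeight l p = 0 := by
  simp [channelWeight, h]

theorem channelWeight_eq_zero_iff {l : Fin (L + 1)} {p : Fin (n l)} :
    channelWeight l p = 0 ↔ l = 0 ∨ l = Fin.last L := by
  refine ⟨fun h => ?_, fun h => channelWeight_of_end h p⟩
  by_contra hl
  have := congrFun h ⟨l, p⟩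
  simp [channelWeight_apply, hl] at this

theorem channelWeight_apply_eq_one {l : Fin (L + 1)} {p : Fin (n l)} {v : Σ l, Fin (n l)}
    (h : 0 < channelWeight l p v) : (⟨l, p⟩ : Σ l, Fin (n l)) = v := by
  by_contra hv
  simp [channelWeight_apply, Ne.symm hv] at h

theorem channelWeight_nonneg (l : Fin (L + 1)) (p : Fin (n l)) (v : Σ l, Fin (n l)) :
    0 ≤ channelWeight l p v := by
  rw [channelWeight_apply]
  split_ifs <;> norm_num

theorem channelWeight_self {l : Fin (L + 1)} (h : ¬(l = 0 ∨ l = Fin.last L)) (p : Fin (n l)) :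
    channelWeight l p ⟨l, p⟩ = 1 := by
  simp [channelWeight_apply, h]

theorem channelWeight_congr {s a : Fin (L + 1)} {p : Fin (n s)} {x : Fin (n a)}
    (h : (⟨s, p⟩ : Σ l, Fin (n l)) = ⟨a, x⟩) : channelWeight s p = channelWeight a x := by
  cases h
  rfl

theorem channelWeight_of_ne {a b : Fin (L + 1)} (hab : a ≠ b) (x : Fin (n a)) (y : Fin (n b)) :
    channelWeight a x ⟨b, y⟩ = 0 := by
  rw [channelWeight_apply, if_pos]
  refine Or.inr fun h => hab ?_
  exact (congrArg Sigma.fst h).symm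

variable {s t a b : Fin (L + 1)} {p : Fin (n s)} {q : Fin (n t)} {x : Fin (n a)} {y : Fin (n b)}

/-- Evaluation at `⟨a, x⟩` gives `1` on the right. As weights are nonnegative, the positive term on
the left must be positive there, which identifies its channel; `⟨b, y⟩` does the same for the
negative term. -/
theorem channelWeight_sub_eq_sub_iff (ha : ¬(a = 0 ∨ a = Fin.last L))
    (hb : ¬(b = 0 ∨ b = Fin.last L)) (hab : a ≠ b) :
    channelWeight s p - channelWeight t q = channelWeight a x - channelWeight b y ↔
      (⟨s, p⟩ : Σ l, Fin (n l)) = ⟨a, x⟩ ∧ (⟨t, q⟩ : Σ l, Fin (n l)) = ⟨b, y⟩ := by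
  constructor
  · intro h
    have h1 := congrFun h ⟨a, x⟩
    have h2 := congrFun h ⟨b, y⟩
    simp only [Pi.sub_apply, channelWeight_self ha, channelWeight_self hb,
      channelWeight_of_ne hab, channelWeight_of_ne hab.symm] at h1 h2
    exact ⟨channelWeight_apply_eq_one (by linarith [channelWeight_nonneg t q ⟨a, x⟩]),
      channelWeight_apply_eq_one (by linarith [channelWeight_nonneg s p ⟨b, y⟩])⟩
  · rintro ⟨h1, h2⟩
    rw [channelWeight_congr h1, channelWeight_congr h2]

theorem channelWeight_eq_iff (ha : ¬(a = 0 ∨ a = Fin.last L)) :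
    channelWeight s p = channelWeight a x ↔ (⟨s, p⟩ : Σ l, Fin (n l)) = ⟨a, x⟩ := by
  refine ⟨fun h => channelWeight_apply_eq_one ?_, channelWeight_congr⟩
  rw [h, channelWeight_self ha]
  exact one_pos

theorem channelWeight_sub_eq_iff (ha : ¬(a = 0 ∨ a = Fin.last L)) :
    channelWeight s p - channelWeight t q = channelWeight a x ↔
      (⟨s, p⟩ : Σ l, Fin (n l)) = ⟨a, x⟩ ∧ (t = 0 ∨ t = Fin.last L) := by
  constructor
  · intro h
    have h1 := congrFun h ⟨a, x⟩
    simp only [Pi.sub_apply, channelWeight_self ha] at h1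
    have h2 : (⟨s, p⟩ : Σ l, Fin (n l)) = ⟨a, x⟩ :=
      channelWeight_apply_eq_one (by linarith [channelWeight_nonneg t q ⟨a, x⟩])
    refine ⟨h2, ?_⟩
    rwa [channelWeight_congr h2, sub_eq_self, channelWeight_eq_zero_iff] at h
  · rintro ⟨h1, h2⟩
    rw [channelWeight_congr h1, channelWeight_of_end h2, sub_zero]

theorem channelWeight_sub_eq_neg_iff (hb : ¬(b = 0 ∨ b = Fin.last L)) :
    channelWeight s p - channelWeight t q = -channelWeight b y ↔
      (s = 0 ∨ s = Fin.last L) ∧ (⟨t, q⟩ : Σ l, Fin (n l)) = ⟨b, y⟩ := by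
  rw [← neg_inj, neg_sub, neg_neg, channelWeight_sub_eq_iff hb, and_comm]

theorem channelWeight_ne_sub (hb : ¬(b = 0 ∨ b = Fin.last L)) (hab : a ≠ b) :
    channelWeight s p ≠ channelWeight a x - channelWeight b y := by
  intro h
  have := congrFun h ⟨b, y⟩
  simp only [Pi.sub_apply, channelWeight_self hb, channelWeight_of_ne hab] at this
  linarith [channelWeight_nonneg s p ⟨b, y⟩]

theorem channelWeight_ne_neg (hb : ¬(b = 0 ∨ b = Fin.last L)) :
    channelWeight s p ≠ -channelWeight b y := by
  intro h
  have := congrFun h ⟨b, y⟩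
  simp only [Pi.neg_apply, channelWeight_self hb] at this
  linarith [channelWeight_nonneg s p ⟨b, y⟩]

theorem zero_ne_channelWeight_sub (ha : ¬(a = 0 ∨ a = Fin.last L)) (hab : a ≠ b) :
    0 ≠ channelWeight a x - channelWeight b y := by
  intro h
  have := congrFun h ⟨a, x⟩
  simp [channelWeight_self ha, channelWeight_of_ne hab.symm] at this

/-- The first alternative yields the full sums between the end layers, the second the diagonal
entries that make up the traces. -/
theorem channelWeight_sub_eq_zero_iff :
    channelWeight s p - channelWeight t q = 0 ↔
      ((s = 0 ∨ s = Fin.last L) ∧ (t = 0 ∨ t = Fin.last L)) ∨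
        (⟨s, p⟩ : Σ l, Fin (n l)) = ⟨t, q⟩ := by
  by_cases ht : t = 0 ∨ t = Fin.last L
  · rw [channelWeight_of_end ht, sub_zero, channelWeight_eq_zero_iff]
    refine ⟨fun h => Or.inl ⟨h, ht⟩, ?_⟩
    rintro (h | h)
    · exact h.1
    · rw [Sigma.mk.injEq] at h
      exact h.1 ▸ ht
  · rw [sub_eq_zero, channelWeight_eq_iff ht]
    simp [ht]

end ChannelWeight

/-- Used when the weight condition leaves a single pair of layers. -/
theorem sum_layers {ι κ M : Type*} [Fintype ι] [AddCommMonoid M] {α : ι → Type*}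
    {β : κ → Type*} [∀ s, Fintype (α s)] [∀ t, Fintype (β t)] {A : ι → Finset κ}
    {F : (s : ι) → (t : κ) → α s → β t → M} (i : ι) (i' : κ) (hi' : i' ∈ A i)
    (h : ∀ s, ∀ t ∈ A s, s ≠ i → ∀ p q, F s t p q = 0) (h' : ∀ t ∈ A i, t ≠ i' → ∀ p q, F i t p q = 0) :
    ∑ s, ∑ t ∈ A s, ∑ p, ∑ q, F s t p q = ∑ p, ∑ q, F i i' p q := by
  rw [Finset.sum_eq_single i, Finset.sum_eq_single i']
  · intro t ht hne
    exact Finset.sum_eq_zero fun p _ => Finset.sum_eq_zero fun q _ => h' t ht hne p q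
  · exact fun h => absurd hi' h
  · intro s _ hs
    exact Finset.sum_eq_zero fun t ht => Finset.sum_eq_zero fun p _ =>
      Finset.sum_eq_zero fun q _ => h s t ht hs p q
  · simp

/-! ### Terms of a prescribed nonzero weight -/

section Parts

variable {L : ℕ} {n : Fin (L + 1) → ℕ} {d d' : ℕ}

/-- The function `f` has weight `u₀` under the scaling action. -/
def HasWeight (f : WeightSpace L n d → Fin d' → ℝ) (u₀ : (Σ l, Fin (n l)) → ℝ) : Prop :=
  ∀ x, ∀ g ∈ symmetryGroup L n,
    IsMonomial g (fun l p => Real.exp (channelWeight l p ⬝ᵥ x)) 1 →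
    ∀ U, f (g • U) = Real.exp (u₀ ⬝ᵥ x) • f U

variable {Ψ : Connection L n d} {Φ : Coeffs L n d d'} {f : WeightSpace L n d → Fin d' → ℝ}
  {i : Fin L}

theorem HasWeight.eq_middle {j : Fin (n i.succ)} {k : Fin (n i.castSucc)}
    (hu : HasWeight f (channelWeight i.succ j - channelWeight i.castSucc k))
    (hf : ∀ U, f U = stableComb Ψ Φ U) (hi : i.castSucc ≠ 0) (hi' : i.succ ≠ Fin.last L)
    (U : WeightSpace L n d) :
    f U = Φ.W i.succ i.castSucc j k *ᵥ U.prodW i.succ i.castSucc j k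
      + Φ.WW i.succ i.castSucc j k *ᵥ U.prodWW Ψ i.succ i.castSucc j k
      + Φ.bW i i.castSucc j k *ᵥ U.prodbW Ψ i i.castSucc j k := by
  have ha : ¬(i.succ = 0 ∨ i.succ = Fin.last L) := by simp [hi', Fin.succ_ne_zero]
  have hb : ¬(i.castSucc = 0 ∨ i.castSucc = Fin.last L) := by
    simp [hi, (Fin.castSucc_lt_last i).ne]
  have hab : i.succ ≠ i.castSucc := (Fin.castSucc_lt_succ).ne'
  rw [eq_weight_part hf hu U]
  simp only [channelWeight_sub_eq_sub_iff ha hb hab, channelWeight_ne_sub hb hab,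
    zero_ne_channelWeight_sub ha hab, if_false, Finset.sum_const_zero, add_zero]
  rw [sum_layers i.succ i.castSucc, sum_layers i i.castSucc, sum_layers i i.castSucc]
  · simp only [Sigma.mk.injEq, heq_eq_eq, true_and, ite_and, Finset.sum_ite_eq', Finset.mem_univ,
      if_true, Finset.sum_ite_irrel, Finset.sum_const_zero]
    abel
  all_goals simp +contextual [Fin.castSucc_lt_last]

/-- The second channel must lie in an end layer, and `L` is excluded because `t` is below `s` or
below `L`; so `t = 0`. Since layer `0` has weight zero, the result also serves the weight entries of
layer `1`. -/
theorem HasWeight.eq_bias {j : Fin (n i.succ)} (hu : HasWeight f (channelWeight i.succ j))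
    (hf : ∀ U, f U = stableComb Ψ Φ U) (hi' : i.succ ≠ Fin.last L) (U : WeightSpace L n d) :
    f U = (∑ q, Φ.W i.succ 0 j q *ᵥ U.prodW i.succ 0 j q)
      + (∑ q, Φ.WW i.succ 0 j q *ᵥ U.prodWW Ψ i.succ 0 j q)
      + (∑ t : Fin L with t.succ < i.succ, Φ.Wb i.succ t j *ᵥ U.prodWb i.succ t j 0)
      + (∑ q, Φ.bW i 0 j q *ᵥ U.prodbW Ψ i 0 j q)
      + Φ.b i j *ᵥ U.b i j 0 := by
  have ha : ¬(i.succ = 0 ∨ i.succ = Fin.last L) := by simp [hi', Fin.succ_ne_zero]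
  have h0 : (0 : (Σ l, Fin (n l)) → ℝ) ≠ channelWeight i.succ j := fun h =>
    ha (channelWeight_eq_zero_iff.1 h.symm)
  have hL : (0 : Fin (L + 1)) < Fin.last L := (Fin.zero_le _).trans_lt (Fin.castSucc_lt_last i)
  rw [eq_weight_part hf hu U]
  simp only [channelWeight_sub_eq_iff ha, channelWeight_eq_iff ha, h0, if_false, add_zero]
  rw [sum_layers i.succ 0, sum_layers i 0, sum_layers i 0, Finset.sum_eq_single i,
    Finset.sum_eq_single i.succ]
  · simp only [Sigma.mk.injEq, heq_eq_eq, true_and, true_or, and_true, Finset.sum_ite_eq',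
      Finset.mem_univ, if_true, Finset.sum_ite_irrel, Finset.sum_const_zero]
    abel
  all_goals simp +contextual [hL, Fin.succ_pos]
  all_goals
    intro t ht _ p q _ htL
    subst htL
    exact absurd ht (Fin.le_last _).not_gt

theorem HasWeight.eq_last {k : Fin (n i.castSucc)} (hu : HasWeight f (-channelWeight i.castSucc k))
    (hf : ∀ U, f U = stableComb Ψ Φ U) (hi : i.castSucc ≠ 0) (hi' : i.succ = Fin.last L)
    (U : WeightSpace L n d) :
    f U = (∑ p, Φ.W i.succ i.castSucc p k *ᵥ U.prodW i.succ i.castSucc p k)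
      + (∑ p, Φ.WW i.succ i.castSucc p k *ᵥ U.prodWW Ψ i.succ i.castSucc p k)
      + ∑ p, Φ.bW i i.castSucc p k *ᵥ U.prodbW Ψ i i.castSucc p k := by
  have hb : ¬(i.castSucc = 0 ∨ i.castSucc = Fin.last L) := by
    simp [hi, (Fin.castSucc_lt_last i).ne]
  have h0 : (0 : (Σ l, Fin (n l)) → ℝ) ≠ -channelWeight i.castSucc k := fun h =>
    hb (channelWeight_eq_zero_iff.1 (neg_eq_zero.1 h.symm))
  rw [eq_weight_part hf hu U]
  simp only [channelWeight_sub_eq_neg_iff hb, channelWeight_ne_neg hb, h0, if_false,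
    Finset.sum_const_zero, add_zero]
  rw [sum_layers i.succ i.castSucc, sum_layers i i.castSucc, sum_layers i i.castSucc]
  · simp only [Sigma.mk.injEq, heq_eq_eq, true_and, hi', or_true, Finset.sum_ite_eq',
      Finset.mem_univ, if_true]
    abel
  all_goals simp +contextual [Fin.castSucc_lt_last]
  · intro s t _ hs _ _ hsL
    exact absurd (Fin.succ_injective _ (hsL.trans hi'.symm)) hs
  · intro s t _ hs _ _ hsL
    exact absurd (Fin.succ_injective _ (hsL.trans hi'.symm)) hs
  · rintro s t hts hs p q (rfl | rfl)
    · exact absurd hts (Fin.zero_le _).not_gt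
    · exact absurd hi'.symm hs

end Parts

/-! ### Terms of weight zero -/

section Diagonal

variable {L : ℕ} {n : Fin (L + 1) → ℕ} {d d' : ℕ}

open Classical in
-- For `s.succ = L` weight zero forces `t = 0`, because `t < L`. For a hidden `s.succ` it forces
-- equal channels, which leaves a diagonal sum.
theorem sum_weight_zero {M : Type*} [AddCommMonoid M] {i : Fin L} (hi' : i.succ = Fin.last L)
    (X : (s : Fin L) → (t : Fin (L + 1)) → Fin (n s.succ) → Fin (n t) → M) :
    (∑ s : Fin L, ∑ t : Fin (L + 1) with t < Fin.last L, ∑ p, ∑ q,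
      if channelWeight s.succ p - channelWeight t q = 0 then X s t p q else 0) =
    (∑ p, ∑ q, X i 0 p q) + ∑ s : Fin L with s.succ < Fin.last L, ∑ p, X s s.succ p p := by
  have hL : (0 : Fin (L + 1)) < Fin.last L := (Fin.zero_le _).trans_lt (Fin.castSucc_lt_last i)
  rw [← Finset.sum_filter_add_sum_filter_not Finset.univ (fun s : Fin L => s.succ < Fin.last L),
    add_comm]
  simp only [channelWeight_sub_eq_zero_iff]
  congr 1
  · have : (Finset.univ.filter fun s : Fin L => ¬s.succ < Fin.last L) = {i} := by
      ext s
      rw [Finset.mem_filter, Finset.mem_singleton, ← hi', not_lt]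
      refine ⟨fun h => Fin.succ_injective _ (le_antisymm ?_ h.2), ?_⟩
      · rw [hi']
        exact Fin.le_last _
      · rintro rfl
        exact ⟨Finset.mem_univ _, le_rfl⟩
    rw [this, Finset.sum_singleton, Finset.sum_eq_single 0]
    · simp [hi']
    · intro t ht ht0
      have htL := (Finset.mem_filter.1 ht).2
      refine Finset.sum_eq_zero fun p _ => Finset.sum_eq_zero fun q _ => if_neg ?_
      rintro (h | h)
      · exact h.2.elim ht0 htL.ne
      · exact htL.ne ((congrArg Sigma.fst h).symm.trans hi')
    · simp [hL]
  · refine Finset.sum_congr rfl fun s hs => ?_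
    have hsL := (Finset.mem_filter.1 hs).2
    have hs' : ¬(s.succ = 0 ∨ s.succ = Fin.last L) := by simp [hsL.ne, Fin.succ_ne_zero]
    rw [Finset.sum_eq_single s.succ]
    · simp [hsL.ne]
    · intro t _ hts
      refine Finset.sum_eq_zero fun p _ => Finset.sum_eq_zero fun q _ => if_neg ?_
      rintro (h | h)
      · exact hs' h.1
      · exact hts (congrArg Sigma.fst h).symm
    · simp [hsL]

variable {Ψ : Connection L n d} {Φ : Coeffs L n d d'} {f : WeightSpace L n d → Fin d' → ℝ}
  {i : Fin L}

theorem HasWeight.eq_zero (hu : HasWeight f 0)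
    (hf : ∀ U, f U = stableComb Ψ Φ U) (hi' : i.succ = Fin.last L) (U : WeightSpace L n d) :
    f U = (∑ p, ∑ q, Φ.WW i.succ 0 p q *ᵥ U.prodWW Ψ i.succ 0 p q)
      + (∑ p, ∑ q, Φ.W i.succ 0 p q *ᵥ U.prodW i.succ 0 p q)
      + (∑ s : Fin L with s.succ < Fin.last L, ∑ p,
        Φ.WW s.succ s.succ p p *ᵥ U.prodWW Ψ s.succ s.succ p p)
      + (∑ p, ∑ q, Φ.bW i 0 p q *ᵥ U.prodbW Ψ i 0 p q)
      + (∑ t : Fin L with t.succ < Fin.last L, ∑ p, Φ.Wb i.succ t p *ᵥ U.prodWb i.succ t p 0)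
      + (∑ t : Fin L with t.succ < Fin.last L, ∑ p,
        Φ.bW t t.succ p p *ᵥ U.prodbW Ψ t t.succ p p)
      + (∑ p, Φ.b i p *ᵥ U.b i p 0)
      + Φ.bias := by
  have hfilter : (Finset.univ.filter fun t : Fin L => t.succ < Fin.last L) =
      Finset.univ.filter fun t : Fin L => t.succ < i.succ := by rw [hi']
  rw [eq_weight_part hf hu U, sum_weight_zero hi', sum_weight_zero hi']
  simp only [channelWeight_sub_eq_zero_iff, channelWeight_eq_zero_iff, if_true]
  rw [sum_layers i.succ 0, Finset.sum_eq_single i, Finset.sum_eq_single i.succ]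
  · simp only [hfilter]
    simp only [hi', or_true, true_or, and_true, if_true]
    abel
  · intro s _ hs
    refine Finset.sum_eq_zero fun t ht => Finset.sum_eq_zero fun p _ => if_neg ?_
    rintro (rfl | rfl)
    · exact absurd (Finset.mem_filter.1 ht).2 (Fin.zero_le _).not_gt
    · exact hs hi'.symm
  · simp
  · intro s _ hs
    refine Finset.sum_eq_zero fun p _ => if_neg ?_
    rintro (h | h)
    · exact Fin.succ_ne_zero _ h
    · exact hs (Fin.succ_injective _ (h.trans hi'.symm))
  · simp
  · simp [Fin.succ_pos]
  · intro s t ht hs p q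
    have hts := (Finset.mem_filter.1 ht).2
    refine if_neg ?_
    rintro (⟨rfl | rfl, -⟩ | h)
    · exact absurd hts (Fin.zero_le _).not_gt
    · exact hs hi'.symm
    · exact hts.ne (congrArg Sigma.fst h).symm
  · intro t ht ht0 p q
    have hts := (Finset.mem_filter.1 ht).2
    refine if_neg ?_
    rintro (⟨-, rfl | rfl⟩ | h)
    · exact ht0 rfl
    · exact absurd hts (Fin.le_last _).not_gt
    · exact hts.ne (congrArg Sigma.fst h).symm

end Diagonal

/-! ### Averaging over permutations -/

section Average

variable {Λ : Type*} [Fintype Λ] [DecidableEq Λ] {m : Λ → ℕ}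

/-- Right multiplication by a transposition shows that the sum does not depend on `p`. Summing over
all `p` therefore multiplies it by `m l`, while each single `σ` contributes `∑ q, Y q`. -/
theorem sum_perm_apply {M : Type*} [AddCommGroup M] [Module ℝ M] (l : Λ) (p : Fin (m l))
    (Y : Fin (m l) → M) :
    ∑ σ : (l : Λ) → Equiv.Perm (Fin (m l)), Y (σ l p) =
      ((Fintype.card ((l : Λ) → Equiv.Perm (Fin (m l))) : ℝ) * (m l : ℝ)⁻¹) • ∑ q, Y q := by
  have hindep : ∀ q, ∑ σ : (l : Λ) → Equiv.Perm (Fin (m l)), Y (σ l q) =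
      ∑ σ : (l : Λ) → Equiv.Perm (Fin (m l)), Y (σ l p) := by
    intro q
    rw [← Equiv.sum_comp (Equiv.mulRight (Pi.mulSingle l (Equiv.swap p q)))
      fun σ : (l : Λ) → Equiv.Perm (Fin (m l)) => Y (σ l q)]
    simp
  have hsum : (m l : ℝ) • ∑ σ : (l : Λ) → Equiv.Perm (Fin (m l)), Y (σ l p) =
      (Fintype.card ((l : Λ) → Equiv.Perm (Fin (m l))) : ℝ) • ∑ q, Y q := by
    calc _ = ∑ q, ∑ σ : (l : Λ) → Equiv.Perm (Fin (m l)), Y (σ l q) := by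
          simp only [hindep, Finset.sum_const, Finset.card_univ, Fintype.card_fin,
            Nat.cast_smul_eq_nsmul]
      _ = _ := by
          rw [Finset.sum_comm]
          simp only [Equiv.sum_comp, Finset.sum_const, Finset.card_univ, Nat.cast_smul_eq_nsmul]
  have hm : (m l : ℝ) ≠ 0 := Nat.cast_ne_zero.2 (Nat.pos_of_ne_zero fun h => by
    rw [h] at p
    exact p.elim0).ne'
  rw [mul_comm, mul_smul, ← hsum, inv_smul_smul₀ hm]

theorem average_perm_mulVec {d d' : ℕ} (l : Λ) (A : Fin (m l) → Matrix (Fin d') (Fin d) ℝ)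
    (Y : Fin (m l) → Fin d → ℝ) :
    (Fintype.card ((l : Λ) → Equiv.Perm (Fin (m l))) : ℝ)⁻¹ •
      ∑ σ : (l : Λ) → Equiv.Perm (Fin (m l)), ∑ p, A p *ᵥ Y (σ l p) =
    ∑ q, ((m l : ℝ)⁻¹ • ∑ p, A p) *ᵥ Y q := by
  have hN : (Fintype.card ((l : Λ) → Equiv.Perm (Fin (m l))) : ℝ) ≠ 0 :=
    Nat.cast_ne_zero.2 Fintype.card_ne_zero
  rw [Finset.sum_comm]
  simp only [← Matrix.mulVec_sum, sum_perm_apply, Matrix.mulVec_smul, mul_smul]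
  rw [← Finset.smul_sum, inv_smul_smul₀ hN, ← Finset.smul_sum, ← Matrix.sum_mulVec,
    Matrix.smul_mulVec]

end Average

/-! ### Equivariance forces the listed forms -/

section Forward

variable {L : ℕ} {n : Fin (L + 1) → ℕ} {d d' : ℕ}

theorem exists_permutation (π : (l : Fin (L + 1)) → Equiv.Perm (Fin (n l)))
    (hπ : ∀ l, l = 0 ∨ l = Fin.last L → π l = 1) :
    ∃ g ∈ symmetryGroup L n, IsMonomial g 1 π :=
  exists_mem_symmetryGroup 1 π (fun _ _ => one_pos) (fun _ _ => rfl) hπ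

theorem exists_transposition {l : Fin (L + 1)} (hl : ¬(l = 0 ∨ l = Fin.last L)) (a b : Fin (n l)) :
    ∃ g ∈ symmetryGroup L n, ∃ π, IsMonomial g 1 π ∧ π l a = b ∧ ∀ l', l' ≠ l → π l' = 1 := by
  obtain ⟨g, hg, h⟩ := exists_permutation (n := n) (Pi.mulSingle l (Equiv.swap a b)) fun l' hl' =>
    Pi.mulSingle_eq_of_ne (fun e => hl (by rwa [e] at hl')) _
  exact ⟨g, hg, _, h, by simp, fun l' h' => Pi.mulSingle_eq_of_ne h' _⟩

theorem filter_succ_lt_succ_eq_empty {i : Fin L} (hi : i.castSucc = 0) :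
    (Finset.univ.filter fun t : Fin L => t.succ < i.succ) = ∅ := by
  refine Finset.filter_eq_empty_iff.2 fun t _ => ?_
  rw [Fin.succ_lt_succ_iff, Fin.lt_def]
  have : (i : ℕ) = 0 := congrArg Fin.val hi
  omega

variable {Ψ : Connection L n d} {E : WeightSpace L n d → WeightSpace L n d'} {i : Fin L}
  (hE : IsPolynomialLayer Ψ E) (hG : IsEquivariant E)

include hG

theorem IsEquivariant.hasWeight_W (j : Fin (n i.succ)) (k : Fin (n i.castSucc)) :
    HasWeight (fun U => (E U).W i j k) (channelWeight i.succ j - channelWeight i.castSucc k) := by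
  intro x g hg h U
  dsimp only
  rw [((isEquivariant_iff E).1 hG g _ _ hg h U i j).1 k]
  simp only [Pi.one_apply, Equiv.Perm.one_apply, sub_dotProduct, Real.exp_sub, div_eq_mul_inv]

theorem IsEquivariant.hasWeight_b (j : Fin (n i.succ)) :
    HasWeight (fun U => (E U).b i j 0) (channelWeight i.succ j) := by
  intro x g hg h U
  dsimp only
  rw [((isEquivariant_iff E).1 hG g _ _ hg h U i j).2]
  simp only [Pi.one_apply, Equiv.Perm.one_apply]

theorem IsEquivariant.W_perm {g : (l : Fin (L + 1)) → GL (Fin (n l)) ℝ}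
    {π : (l : Fin (L + 1)) → Equiv.Perm (Fin (n l))} (hg : g ∈ symmetryGroup L n)
    (h : IsMonomial g 1 π) (U : WeightSpace L n d) (j : Fin (n i.succ)) (k : Fin (n i.castSucc)) :
    (E U).W i (π _ j) (π _ k) = (E (g • U)).W i j k := by
  rw [((isEquivariant_iff E).1 hG g _ _ hg h U i j).1 k]
  simp

theorem IsEquivariant.b_perm {g : (l : Fin (L + 1)) → GL (Fin (n l)) ℝ}
    {π : (l : Fin (L + 1)) → Equiv.Perm (Fin (n l))} (hg : g ∈ symmetryGroup L n)
    (h : IsMonomial g 1 π) (U : WeightSpace L n d) (j : Fin (n i.succ)) :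
    (E U).b i (π _ j) 0 = (E (g • U)).b i j 0 := by
  rw [((isEquivariant_iff E).1 hG g _ _ hg h U i j).2]
  simp

include hE

theorem IsEquivariant.weightFormMiddle (hi : i.castSucc ≠ 0) (hi' : i.succ ≠ Fin.last L) :
    WeightFormMiddle Ψ E i := by
  have ha : ¬(i.succ = 0 ∨ i.succ = Fin.last L) := by simp [hi', Fin.succ_ne_zero]
  have hb : ¬(i.castSucc = 0 ∨ i.castSucc = Fin.last L) := by
    simp [hi, (Fin.castSucc_lt_last i).ne]
  have hab : i.succ ≠ i.castSucc := (Fin.castSucc_lt_succ).ne'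
  rcases isEmpty_or_nonempty (Fin (n i.succ)) with _ | ⟨⟨j₀⟩⟩
  · exact ⟨0, 0, 0, fun _ j => isEmptyElim j⟩
  rcases isEmpty_or_nonempty (Fin (n i.castSucc)) with _ | ⟨⟨k₀⟩⟩
  · exact ⟨0, 0, 0, fun _ _ k => isEmptyElim k⟩
  obtain ⟨Φ, hΦ⟩ := hE.1 i j₀ k₀
  refine ⟨Φ.W i.succ i.castSucc j₀ k₀, Φ.WW i.succ i.castSucc j₀ k₀, Φ.bW i i.castSucc j₀ k₀,
    fun U j k => ?_⟩
  -- The row is moved from `j₀` to `j` and the column from `k₀` to `k` by separate transpositions.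
  -- Their layers differ, so each leaves the other index fixed.
  obtain ⟨g₁, hg₁, π₁, h₁, hj, hπ₁⟩ := exists_transposition ha j₀ j
  obtain ⟨g₂, hg₂, π₂, h₂, hk, hπ₂⟩ := exists_transposition hb k₀ k
  have e₁ := hG.W_perm hg₁ h₁ U j₀ k
  rw [hj, hπ₁ _ hab.symm, Equiv.Perm.one_apply] at e₁
  have e₂ := hG.W_perm hg₂ h₂ (g₁ • U) j₀ k₀
  rw [hk, hπ₂ _ hab, Equiv.Perm.one_apply] at e₂
  rw [e₁, e₂, (hG.hasWeight_W j₀ k₀).eq_middle hΦ hi hi']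
  simp only [h₁.prodW_apply, h₁.prodWW_apply, h₁.prodbW_apply, h₂.prodW_apply, h₂.prodWW_apply,
    h₂.prodbW_apply, hj, hk, hπ₁ _ hab.symm, hπ₂ _ hab, Equiv.Perm.one_apply, Pi.one_apply,
    inv_one, mul_one, one_smul]

/-- The common shape of the equivariant bias outputs below the last layer. -/
theorem IsEquivariant.biasFormMiddle (hi' : i.succ ≠ Fin.last L) : BiasFormMiddle Ψ E i := by
  have ha : ¬(i.succ = 0 ∨ i.succ = Fin.last L) := by simp [hi', Fin.succ_ne_zero]
  rcases isEmpty_or_nonempty (Fin (n i.succ)) with _ | ⟨⟨j₀⟩⟩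
  · exact ⟨0, 0, 0, 0, 0, fun _ j => isEmptyElim j⟩
  obtain ⟨Φ, hΦ⟩ := hE.2 i j₀
  refine ⟨fun q => Φ.W i.succ 0 j₀ q, fun q => Φ.WW i.succ 0 j₀ q, fun q => Φ.bW i 0 j₀ q,
    fun t => Φ.Wb i.succ t j₀, Φ.b i j₀, fun U j => ?_⟩
  obtain ⟨g, hg, π, h, hj, hπ⟩ := exists_transposition ha j₀ j
  have e := hG.b_perm hg h U j₀
  rw [hj] at e
  rw [e, (hG.hasWeight_b j₀).eq_bias hΦ hi']
  simp only [h.prodW_apply, h.prodWW_apply, h.prodbW_apply, h.prodWb_apply, h.smul_b_apply,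
    hj, h.perm_zero, Equiv.Perm.one_apply, Pi.one_apply, inv_one, mul_one, one_smul]

theorem IsEquivariant.biasFormFirst (hi : i.castSucc = 0) (hi' : i.succ ≠ Fin.last L) :
    BiasFormFirst Ψ E i := by
  obtain ⟨φW, φWW, φbW, φWb, φb, h⟩ := hG.biasFormMiddle hE hi'
  refine ⟨φW, φWW, φbW, φb, fun U j => ?_⟩
  rw [h, filter_succ_lt_succ_eq_empty hi, Finset.sum_empty, add_zero]

theorem IsEquivariant.weightFormFirst (hi : i.castSucc = 0) (hi' : i.succ ≠ Fin.last L) :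
    WeightFormFirst Ψ E i := by
  have ha : ¬(i.succ = 0 ∨ i.succ = Fin.last L) := by simp [hi', Fin.succ_ne_zero]
  rcases isEmpty_or_nonempty (Fin (n i.succ)) with _ | ⟨⟨j₀⟩⟩
  · exact ⟨0, 0, 0, 0, fun _ j => isEmptyElim j⟩
  -- Layer `0` is not permuted, so each column `k` keeps its own coefficients and only the row is
  -- transported.
  choose Φ hΦ using hE.1 i j₀
  refine ⟨fun k q => (Φ k).W i.succ 0 j₀ q, fun k q => (Φ k).WW i.succ 0 j₀ q,
    fun k q => (Φ k).bW i 0 j₀ q, fun k => (Φ k).b i j₀, fun U j k => ?_⟩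
  obtain ⟨g, hg, π, h, hj, hπ⟩ := exists_transposition ha j₀ j
  have e := hG.W_perm hg h U j₀ k
  rw [hj, h.perm_end _ (Or.inl hi), Equiv.Perm.one_apply] at e
  -- The column lies in layer `0` and has weight zero, so the entry has the weight of a bias. The
  -- `Wb` terms vanish because no layer lies strictly between `0` and `1`.
  have hw := hG.hasWeight_W j₀ k
  rw [channelWeight_of_end (Or.inl hi), sub_zero] at hw
  rw [e, hw.eq_bias (hΦ k) hi', filter_succ_lt_succ_eq_empty hi, Finset.sum_empty, add_zero]
  simp only [h.prodW_apply, h.prodWW_apply, h.prodbW_apply, h.smul_b_apply,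
    hj, h.perm_zero, Equiv.Perm.one_apply, Pi.one_apply, inv_one, mul_one, one_smul]

theorem IsEquivariant.weightFormLast (hi : i.castSucc ≠ 0) (hi' : i.succ = Fin.last L) :
    WeightFormLast Ψ E i := by
  have hb : ¬(i.castSucc = 0 ∨ i.castSucc = Fin.last L) := by
    simp [hi, (Fin.castSucc_lt_last i).ne]
  rcases isEmpty_or_nonempty (Fin (n i.castSucc)) with _ | ⟨⟨k₀⟩⟩
  · exact ⟨0, 0, 0, fun _ _ k => isEmptyElim k⟩
  choose Φ hΦ using fun j => hE.1 i j k₀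
  refine ⟨fun j p => (Φ j).W i.succ i.castSucc p k₀, fun j p => (Φ j).WW i.succ i.castSucc p k₀,
    fun j p => (Φ j).bW i i.castSucc p k₀, fun U j k => ?_⟩
  obtain ⟨g, hg, π, h, hk, hπ⟩ := exists_transposition hb k₀ k
  have e := hG.W_perm hg h U j k₀
  rw [hk, h.perm_end _ (Or.inr hi'), Equiv.Perm.one_apply] at e
  have hw := hG.hasWeight_W j k₀
  rw [channelWeight_of_end (Or.inr hi'), zero_sub] at hw
  rw [e, hw.eq_last (hΦ j) hi hi']
  simp only [h.prodW_apply, h.prodWW_apply, h.prodbW_apply, hk, h.perm_end _ (Or.inr hi'),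
    Equiv.Perm.one_apply, Pi.one_apply, inv_one, mul_one, one_smul]

/-- The output is unchanged when hidden channels are permuted. Averaging its representation over all
such permutations gives the same function, with the diagonal coefficients replaced by their means.
-/
theorem IsEquivariant.biasFormLast (hi' : i.succ = Fin.last L) : BiasFormLast Ψ E i := by
  classical
  choose Φ hΦ using hE.2 i
  refine ⟨fun j p q => (Φ j).WW i.succ 0 p q, fun j p q => (Φ j).W i.succ 0 p q,
    fun j p q => (Φ j).bW i 0 p q,
    fun j s => (n s.succ : ℝ)⁻¹ • ∑ p, (Φ j).WW s.succ s.succ p p,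
    fun j t => (n t.succ : ℝ)⁻¹ • ∑ p, (Φ j).bW t t.succ p p,
    fun j t p => (Φ j).Wb i.succ t p, fun j p => (Φ j).b i p, fun j => (Φ j).bias,
    fun U j => ?_⟩
  have hw := hG.hasWeight_b (i := i) j
  rw [channelWeight_of_end (Or.inr hi')] at hw
  let N : ℝ := Fintype.card ((l : Fin (L + 1)) → Equiv.Perm (Fin (n l)))
  have hN : N ≠ 0 := Nat.cast_ne_zero.2 Fintype.card_ne_zero
  have hconst : ∀ v : Fin d' → ℝ,
      N⁻¹ • ∑ _σ : (l : Fin (L + 1)) → Equiv.Perm (Fin (n l)), v = v := by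
    intro v
    rw [Finset.sum_const, Finset.card_univ, ← Nat.cast_smul_eq_nsmul ℝ, inv_smul_smul₀ hN]
  have hσ : ∀ σ : (l : Fin (L + 1)) → Equiv.Perm (Fin (n l)), (E U).b i j 0 =
      (∑ p, ∑ q, (Φ j).WW i.succ 0 p q *ᵥ U.prodWW Ψ i.succ 0 p q)
      + (∑ p, ∑ q, (Φ j).W i.succ 0 p q *ᵥ U.prodW i.succ 0 p q)
      + (∑ s : Fin L with s.succ < Fin.last L, ∑ p,
        (Φ j).WW s.succ s.succ p p *ᵥ
          U.prodWW Ψ s.succ s.succ (σ s.succ p) (σ s.succ p))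
      + (∑ p, ∑ q, (Φ j).bW i 0 p q *ᵥ U.prodbW Ψ i 0 p q)
      + (∑ t : Fin L with t.succ < Fin.last L, ∑ p,
        (Φ j).Wb i.succ t p *ᵥ U.prodWb i.succ t p 0)
      + (∑ t : Fin L with t.succ < Fin.last L, ∑ p,
        (Φ j).bW t t.succ p p *ᵥ U.prodbW Ψ t t.succ (σ t.succ p) (σ t.succ p))
      + (∑ p, (Φ j).b i p *ᵥ U.b i p 0)
      + (Φ j).bias := by
    intro σ
    -- The average runs over permutations of all layers, including the end layers where `G` is
    -- trivial. Resetting `σ` there is harmless, since the traces involve hidden layers only.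
    let ρ : (l : Fin (L + 1)) → Equiv.Perm (Fin (n l)) := fun l =>
      if l = 0 ∨ l = Fin.last L then 1 else σ l
    have hρ : ∀ s : Fin L, s.succ < Fin.last L → ρ s.succ = σ s.succ := fun s hs =>
      if_neg (by simp [hs.ne, Fin.succ_ne_zero])
    obtain ⟨g, hg, h⟩ := exists_permutation ρ fun l hl => if_pos hl
    have e := hG.b_perm hg h U j
    rw [h.perm_end _ (Or.inr hi'), Equiv.Perm.one_apply] at e
    rw [e, hw.eq_zero (hΦ j) hi']
    have h1 : (∑ s : Fin L with s.succ < Fin.last L, ∑ p,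
        (Φ j).WW s.succ s.succ p p *ᵥ (g • U).prodWW Ψ s.succ s.succ p p) =
        ∑ s : Fin L with s.succ < Fin.last L, ∑ p,
        (Φ j).WW s.succ s.succ p p *ᵥ U.prodWW Ψ s.succ s.succ (σ s.succ p) (σ s.succ p) := by
      refine Finset.sum_congr rfl fun s hs => Finset.sum_congr rfl fun p _ => ?_
      rw [h.prodWW_apply, hρ s (Finset.mem_filter.1 hs).2]
      simp
    have h2 : (∑ s : Fin L with s.succ < Fin.last L, ∑ p,
        (Φ j).bW s s.succ p p *ᵥ (g • U).prodbW Ψ s s.succ p p) =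
        ∑ s : Fin L with s.succ < Fin.last L, ∑ p,
        (Φ j).bW s s.succ p p *ᵥ U.prodbW Ψ s s.succ (σ s.succ p) (σ s.succ p) := by
      refine Finset.sum_congr rfl fun s hs => Finset.sum_congr rfl fun p _ => ?_
      rw [h.prodbW_apply, hρ s (Finset.mem_filter.1 hs).2]
      simp
    rw [h1, h2]
    simp only [h.prodW_apply, h.prodWW_apply, h.prodbW_apply, h.prodWb_apply, h.smul_b_apply,
      h.perm_zero, h.perm_end _ (Or.inr hi'), Equiv.Perm.one_apply, Pi.one_apply, inv_one, mul_one,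
      one_smul]
  have havg : ∀ (A : (s : Fin L) → Fin (n s.succ) → Matrix (Fin d') (Fin d) ℝ)
      (Y : (s : Fin L) → Fin (n s.succ) → Fin d → ℝ),
      N⁻¹ • ∑ σ : (l : Fin (L + 1)) → Equiv.Perm (Fin (n l)),
        ∑ s : Fin L with s.succ < Fin.last L, ∑ p, A s p *ᵥ Y s (σ s.succ p) =
      ∑ s : Fin L with s.succ < Fin.last L, ∑ q, ((n s.succ : ℝ)⁻¹ • ∑ p, A s p) *ᵥ Y s q := by
    intro A Y
    rw [Finset.sum_comm, Finset.smul_sum]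
    exact Finset.sum_congr rfl fun s _ => average_perm_mulVec s.succ (A s) (Y s)
  calc (E U).b i j 0
      = N⁻¹ • ∑ _σ : (l : Fin (L + 1)) → Equiv.Perm (Fin (n l)), (E U).b i j 0 := (hconst _).symm
    _ = _ := by
      rw [Finset.sum_congr rfl fun σ _ => hσ σ]
      simp only [Finset.sum_add_distrib (s := Finset.univ (α := (l : Fin (L + 1)) →
        Equiv.Perm (Fin (n l)))), smul_add, hconst]
      rw [havg (fun s p => (Φ j).WW s.succ s.succ p p)
          (fun s p => U.prodWW Ψ s.succ s.succ p p),
        havg (fun s p => (Φ j).bW s s.succ p p) (fun s p => U.prodbW Ψ s s.succ p p)]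

end Forward

end PolyNFN

theorem mainTheorem2 {L : ℕ} (hL : 2 ≤ L) (n : Fin (L + 1) → ℕ) (d d' : ℕ)
    (Ψ : PolyNFN.Connection L n d)
    (E : PolyNFN.WeightSpace L n d → PolyNFN.WeightSpace L n d')
    (hE : PolyNFN.IsPolynomialLayer Ψ E) :
    PolyNFN.IsEquivariant E ↔
      ∀ i : Fin L,
        (i.succ = Fin.last L → PolyNFN.WeightFormLast Ψ E i ∧ PolyNFN.BiasFormLast Ψ E i) ∧
        (i.castSucc = 0 → PolyNFN.WeightFormFirst Ψ E i ∧ PolyNFN.BiasFormFirst Ψ E i) ∧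
        (i.castSucc ≠ 0 → i.succ ≠ Fin.last L →
          PolyNFN.WeightFormMiddle Ψ E i ∧ PolyNFN.BiasFormMiddle Ψ E i) := by
  -- By `2 ≤ L` the first and the last layer are distinct, so the three cases exclude one another.
  have hne : ∀ i : Fin L, i.succ = Fin.last L → i.castSucc ≠ 0 := by
    intro i h h'
    have h1 : (i : ℕ) + 1 = L := congrArg Fin.val h
    have h2 : (i : ℕ) = 0 := congrArg Fin.val h'
    omega
  constructor
  · intro hG i
    exact ⟨fun h => ⟨hG.weightFormLast hE (hne i h) h, hG.biasFormLast hE h⟩,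
      fun h => ⟨hG.weightFormFirst hE h fun h' => hne i h' h,
        hG.biasFormFirst hE h fun h' => hne i h' h⟩,
      fun h h' => ⟨hG.weightFormMiddle hE h h', hG.biasFormMiddle hE h'⟩⟩
  · intro H
    rw [PolyNFN.isEquivariant_iff]
    intro g c π _ h U i j
    by_cases hi' : i.succ = Fin.last L
    · obtain ⟨hW, hb⟩ := (H i).1 hi'
      exact ⟨fun k => hW.smul h hi' U j k, hb.smul h hi' U j⟩
    by_cases hi : i.castSucc = 0
    · obtain ⟨hW, hb⟩ := (H i).2.1 hi
      exact ⟨fun k => hW.smul h hi U j k, hb.smul h U j⟩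
    · obtain ⟨hW, hb⟩ := (H i).2.2 hi hi'
      exact ⟨fun k => hW.smul h U j k, hb.smul h U j⟩
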